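/- Let $V$ be a finite-dimensional real vector space with a nondegenerate symmetric bilinear form $\eta$ and a complex structure $J$ such that $\eta(Jv,Jw)=\eta(v,w)$; put $n=\dim_{\mathbb C}(V,J)$, and let $V^{\mathbb C}=V^{1,0}\oplus V^{0,1}$ be the decomposition of the complexification into the $\pm i$-eigenspaces of $J$. Let $Cl$ be the Clifford algebra of $V^{\mathbb C}$, with $v^2=\eta(v,v)$. It is bigraded as a vector space through the isomorphism with $\Lambda(V^{1,0}\oplus V^{0,1})$ for which $v\wedge a=\frac12(va+(-1)^{\deg a}av)$ for $v\in V^{\mathbb C}$. Let $M$ be a smooth manifold with a nondegenerate vielbein $\theta^{\mathbb R}$, i.e. an isomorphism of $TM$ with the trivial bundle with fibre $V$; it induces an almost complex structure on $M$. Let $\theta^{\mathbb R}=\theta+\bar\theta$ be the decomposition into the parts with values in $V^{1,0}$ and $V^{0,1}$, and let $\Omega^{p\bar pq\bar q}$ be the space of differential forms of type $(q,\bar q)$ on $M$ with values in the component of degree $(p,\bar p)$ of $Cl$. Let $\Omega$ be the sum of these spaces, with the product given by the wedge product of forms and the Clifford product of values. Let $\omega\in\Omega^{1110}$, $\bar\omega\in\Omega^{1101}$,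 and suppose that the connection $\omega^{\mathbb R}=\omega+\bar\omega$ (which preserves $\eta$ and $J$) is torsion-free: $d\theta^{\mathbb R}+\omega^{\mathbb R}\theta^{\mathbb R}+\theta^{\mathbb R}\omega^{\mathbb R}=0$. Then its curvature $R^{\mathbb R}=d\omega^{\mathbb R}+(\omega^{\mathbb R})^2$ satisfies $$R^{\mathbb R}=\partial\bar\omega+\bar\partial\omega+\omega\bar\omega+\bar\omega\omega\ \in\ \Omega^{1111},$$ where $\partial$, $\bar\partial$ are the components of $d$ that raise the type by $(1,0)$ and $(0,1)$. Moreover, let $\xi_i$ be a basis of $V^{1,0}$ with conjugate basis $\bar\xi_i$ of $V^{0,1}$, let $\xi^i,\bar\xi^i$ be the dual coframe on $M$ given by $\theta^{\mathbb R}$, let $\eta_{i\bar j}=\eta(\xi_i,\bar\xi_j)$ with inverse matrix $\eta^{i\bar j}$, and identify the values of Clifford forms with elements of $\Lambda(V^{1,0}\oplus V^{0,1})\otimes\Lambda(T^*_{\mathbb C}M)$. Consider the operators on $\Omega$ $$E_0=\xi_i\otimes\xi^i,\quad E_1=\bar\xi_i\otimes\eta^{j\bar i}\tfrac{\partial}{\partial\xi^j},\quad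 E_2=\tfrac{\partial}{\partial\bar\xi_i}\otimes\tfrac{\partial}{\partial\bar\xi^i},\quad E_3=\eta_{j\bar i}\tfrac{\partial}{\partial\xi_j}\otimes\bar\xi^i,$$ $$F_0=\tfrac{\partial}{\partial\xi_i}\otimes\tfrac{\partial}{\partial\xi^i},\quad F_1=\eta_{i\bar j}\tfrac{\partial}{\partial\bar\xi_j}\otimes\xi^i,\quad F_2=\bar\xi_i\otimes\bar\xi^i,\quad F_3=\xi_i\otimes\eta^{i\bar j}\tfrac{\partial}{\partial\bar\xi^j},$$ and $H_0,H_1,H_2,H_3$, which act on $\Omega^{p\bar pq\bar q}$ as multiplication by $p+q-n$, $\bar p-q$, $n-\bar p-\bar q$, $\bar q-p$. On $x$ of total degree $p+\bar p+q+\bar q=m$ one has $2E_0x=\theta x+(-1)^mx\theta$, $2F_1x=\theta x-(-1)^mx\theta$, $2F_2x=\bar\theta x+(-1)^mx\bar\theta$, $2E_3x=\bar\theta x-(-1)^mx\bar\theta$. These operators generate the Lie algebra of operators on $\Omega$ through which $\widehat{\mathfrak{sl}}_4$ acts, with Chevalley generators $E_i,F_i,H_i$. Every element of the subalgebra generated by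 $E_1,F_1,H_1$ and $E_3,F_3,H_3$ annihilates $R^{\mathbb R}$. -/

import Mathlib

open scoped TensorProduct Manifold

attribute [local instance 100] LieRing.ofAssociativeRing

namespace CliffordForms

noncomputable section

/-! ## The complexified vector space and its Clifford algebra

`V` is a real vector space with a symmetric bilinear form `η` and a complex structure `J`; its
complexification is `ℂ ⊗[ℝ] V`. -/

/-- The action of the real numbers on the complex numbers, through the algebra structure. -/
instance (priority := 2000) instModuleRealComplex : Module ℝ ℂ := Algebra.toModule

section Fibre

variable {V : Type*} [AddCommGroup V] [Module ℝ V]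

/-- The projection `v ↦ (v - i J v) / 2` onto the `i`-eigenspace of `J`. -/
def holPart (J : V →ₗ[ℝ] V) : V →ₗ[ℝ] ℂ ⊗[ℝ] V :=
  TensorProduct.mk ℝ ℂ V (1 / 2) - TensorProduct.mk ℝ ℂ V (Complex.I / 2) ∘ₗ J

/-- The projection `v ↦ (v + i J v) / 2` onto the `-i`-eigenspace of `J`. -/
def antiholPart (J : V →ₗ[ℝ] V) : V →ₗ[ℝ] ℂ ⊗[ℝ] V :=
  TensorProduct.mk ℝ ℂ V (1 / 2) + TensorProduct.mk ℝ ℂ V (Complex.I / 2) ∘ₗ J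

/-- The `i`-eigenspace of `J` in the complexification. -/
def holSpace (J : V →ₗ[ℝ] V) : Submodule ℂ (ℂ ⊗[ℝ] V) :=
  Module.End.eigenspace (J.baseChange ℂ) Complex.I

/-- The `-i`-eigenspace of `J` in the complexification. -/
def antiholSpace (J : V →ₗ[ℝ] V) : Submodule ℂ (ℂ ⊗[ℝ] V) :=
  Module.End.eigenspace (J.baseChange ℂ) (-Complex.I)

/-- The complex quadratic form `v ↦ η(v,v)` on the complexification. -/
abbrev quad (η : LinearMap.BilinForm ℝ V) : QuadraticForm ℂ (ℂ ⊗[ℝ] V) :=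
  (LinearMap.BilinForm.baseChange ℂ η).toQuadraticMap

/-- The complex Clifford algebra, with relations `v * v = η(v,v)`. -/
abbrev Cl (η : LinearMap.BilinForm ℝ V) : Type _ := CliffordAlgebra (quad η)

/-- The component of degree `(p, p')` of the Clifford algebra: the subspace that corresponds to
`Λ^p(V^{1,0}) ∧ Λ^{p'}(V^{0,1})` under the linear isomorphism with the exterior algebra. -/
def clType (η : LinearMap.BilinForm ℝ V) (J : V →ₗ[ℝ] V) (p p' : ℕ) : Submodule ℂ (Cl η) :=
  (((holSpace J).map (ExteriorAlgebra.ι ℂ)) ^ p *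
    ((antiholSpace J).map (ExteriorAlgebra.ι ℂ)) ^ p').comap
      (CliffordAlgebra.equivExterior (quad η)).toLinearMap

end Fibre

/-! ## Clifford forms

`A` is the algebra of smooth functions on a manifold `M`. Vector fields are derivations of `A`,
Clifford algebra valued functions are the elements of `Cl ⊗ A`, and `k`-forms are alternating
`A`-multilinear maps on vector fields. -/

section Forms

variable {V : Type*} [AddCommGroup V] [Module ℝ V]

/-- Vector fields. -/
abbrev Vec (A : Type*) [CommRing A] [Algebra ℝ A] : Type _ := Derivation ℝ A A

/-- Functions with values in the complex Clifford algebra, `Cl ⊗ A`. -/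
def Val (A : Type*) [CommRing A] [Algebra ℝ A] (η : LinearMap.BilinForm ℝ V) : Type _ :=
  Cl η ⊗[ℝ] A

section Val

variable (A : Type*) [CommRing A] [Algebra ℝ A] (η : LinearMap.BilinForm ℝ V)

instance instRingVal : Ring (Val A η) := inferInstanceAs (Ring (Cl η ⊗[ℝ] A))

instance instAlgebraRealVal : Algebra ℝ (Val A η) := inferInstanceAs (Algebra ℝ (Cl η ⊗[ℝ] A))

instance (priority := 2000) instModuleRealVal : Module ℝ (Val A η) := Algebra.toModule

instance instAlgebraComplexVal : Algebra ℂ (Val A η) := inferInstanceAs (Algebra ℂ (Cl η ⊗[ℝ] A))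

instance instAlgebraFunVal : Algebra A (Val A η) :=
  (Algebra.TensorProduct.rightAlgebra : Algebra A (Cl η ⊗[ℝ] A))

instance instSMulCommClassVal : SMulCommClass A ℂ (Val A η) where
  smul_comm a c x := by
    rw [Algebra.smul_def a, Algebra.smul_def a, mul_smul_comm]

instance instIsScalarTowerVal : IsScalarTower ℝ A (Val A η) :=
  Algebra.TensorProduct.right_isScalarTower (R := ℝ) (A := Cl η) (B := A)

end Val

/-- Clifford algebra valued 1-forms. -/
abbrev OneForm (A : Type*) [CommRing A] [Algebra ℝ A] (η : LinearMap.BilinForm ℝ V) : Type _ :=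
  Vec A →ₗ[A] Val A η

/-- Clifford algebra valued `k`-forms. -/
abbrev Form (A : Type*) [CommRing A] [Algebra ℝ A] (η : LinearMap.BilinForm ℝ V) (k : ℕ) :
    Type _ :=
  Vec A [⋀^Fin k]→ₗ[A] Val A η

/-- The space of all Clifford forms, the family of the components of all form degrees `k` (those
above the dimension of the manifold vanish). -/
abbrev Omega (A : Type*) [CommRing A] [Algebra ℝ A] (η : LinearMap.BilinForm ℝ V) : Type _ :=
  (k : ℕ) → Form A η k

variable {A : Type*} [CommRing A] [Algebra ℝ A] {η : LinearMap.BilinForm ℝ V}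

/-- A 1-form as an alternating map. -/
def oneForm (α : OneForm A η) : Form A η 1 := AlternatingMap.ofSubsingleton A _ _ (0 : Fin 1) α

/-- A `k`-form as an element of the space of all forms. -/
def ofForm (k : ℕ) (x : Form A η k) : Omega A η := Pi.single k x

/-- The Clifford algebra valued function `c ⊗ a`. -/
def tmul (c : Cl η) (a : A) : Val A η := c ⊗ₜ[ℝ] a

theorem val_induction {motive : Val A η → Prop} (u : Val A η) (zero : motive 0)
    (tmul : ∀ c a, motive (tmul c a)) (add : ∀ u v, motive u → motive v → motive (u + v)) :
    motive u :=
  TensorProduct.induction_on u zero tmul add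

theorem smul_tmul (a b : A) (c : Cl η) : a • tmul c b = tmul c (a * b) := by
  rw [Algebra.smul_def]
  change (1 : Cl η) ⊗ₜ[ℝ] a * c ⊗ₜ[ℝ] b = c ⊗ₜ[ℝ] (a * b)
  rw [Algebra.TensorProduct.tmul_mul_tmul, one_mul]

theorem tmul_add (c : Cl η) (a b : A) : tmul c (a + b) = tmul c a + tmul c b :=
  TensorProduct.tmul_add c a b

/-- The vector field `X` acting on Clifford algebra valued functions, `c ⊗ a ↦ c ⊗ X(a)`. -/
def lieVal (X : Vec A) : Val A η →ₗ[ℝ] Val A η := LinearMap.lTensor (Cl η) (X : A →ₗ[ℝ] A)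

theorem lieVal_tmul (X : Vec A) (c : Cl η) (a : A) : lieVal X (tmul c a) = tmul c (X a) := rfl

theorem lieVal_smul (X : Vec A) (a : A) (u : Val A η) :
    lieVal X (a • u) = a • lieVal X u + X a • u := by
  induction u using val_induction with
  | zero => simp
  | add u v hu hv => simp only [smul_add, map_add, hu, hv]; abel
  | tmul c b =>
    simp only [smul_tmul, lieVal_tmul, Derivation.leibniz, tmul_add, smul_eq_mul, mul_comm b]

theorem lieVal_smul_left (a : A) (X : Vec A) (u : Val A η) :
    lieVal (a • X) u = a • lieVal X u := by
  induction u using val_induction with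
  | zero => simp
  | add u v hu hv => simp only [smul_add, map_add, hu, hv]
  | tmul c b => simp [smul_tmul, lieVal_tmul]

theorem lieVal_add_left (X Y : Vec A) (u : Val A η) :
    lieVal (X + Y) u = lieVal X u + lieVal Y u := by
  induction u using val_induction with
  | zero => simp
  | add u v hu hv => simp only [map_add, hu, hv]; abel
  | tmul c b => simp [lieVal_tmul, tmul_add]

/-- The exterior derivative of a 1-form,
`dα(X,Y) = X(α(Y)) - Y(α(X)) - α([X,Y])`. -/
def d (α : OneForm A η) : Form A η 2 where
  toFun v := lieVal (v 0) (α (v 1)) - lieVal (v 1) (α (v 0)) - α ⁅v 0, v 1⁆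
  map_update_add' := by
    intro inst v i X Y
    obtain rfl : inst = instDecidableEqFin 2 := Subsingleton.elim _ _
    fin_cases i <;> simp [lieVal_add_left] <;> abel
  map_update_smul' := by
    intro inst v i a X
    obtain rfl : inst = instDecidableEqFin 2 := Subsingleton.elim _ _
    have h1 : ∀ Y : Vec A, ⁅a • X, Y⁆ = a • ⁅X, Y⁆ - Y a • X := by
      intro Y
      ext b
      simp [Derivation.commutator_apply]
      ring
    have h2 : ∀ Y : Vec A, ⁅Y, a • X⁆ = a • ⁅Y, X⁆ + Y a • X := by
      intro Y
      ext b
      simp [Derivation.commutator_apply]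
    fin_cases i
    · simp [lieVal_smul_left, lieVal_smul, smul_sub, h1]
      abel
    · simp [lieVal_smul_left, lieVal_smul, smul_sub, h2]
      abel
  map_eq_zero_of_eq' := by
    intro v i j h hij
    fin_cases i <;> fin_cases j <;> simp_all

/-- The product `α x` of a 1-form `α` and a `k`-form `x` (wedge product of forms, Clifford product
of values), `(α x)(v₀,…,v_k) = ∑ᵢ (-1)ⁱ α(vᵢ) x(v₀,…,v̂ᵢ,…,v_k)`. -/
def leftProd {k : ℕ} (α : OneForm A η) (x : Form A η k) : Form A η (k + 1) :=
  AlternatingMap.alternatizeUncurryFin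
    { toFun v := (LinearMap.mulLeft A (α v)).compAlternatingMap x
      map_add' v w := by ext; simp [add_mul]
      map_smul' a v := by ext; simp }

/-- The product `x α` of a `k`-form `x` and a 1-form `α`,
`(x α)(v₀,…,v_k) = (-1)ᵏ ∑ᵢ (-1)ⁱ x(v₀,…,v̂ᵢ,…,v_k) α(vᵢ)`. -/
def rightProd {k : ℕ} (x : Form A η k) (α : OneForm A η) : Form A η (k + 1) :=
  (-1 : ℤ) ^ k • AlternatingMap.alternatizeUncurryFin
    { toFun v := (LinearMap.mulRight A (α v)).compAlternatingMap x
      map_add' v w := by ext; simp [mul_add]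
      map_smul' a v := by ext; simp }

/-- The product of two 1-forms, `(α β)(X,Y) = α(X) β(Y) - α(Y) β(X)`. -/
def prod (α β : OneForm A η) : Form A η 2 := leftProd α (oneForm β)

/-- The curvature `dω + ω ω` of a connection form. -/
def curvature (ω : OneForm A η) : Form A η 2 := d ω + prod ω ω

/-- The torsion `dθ + ω θ + θ ω` of a connection form with respect to a vielbein. -/
def torsion (θ ω : OneForm A η) : Form A η 2 := d θ + prod ω θ + prod θ ω

/-! ### Operators on the space of all Clifford forms -/

/-- The operator on all forms given by operators raising the form degree by one. -/
def raise (T : (k : ℕ) → Form A η k →ₗ[ℂ] Form A η (k + 1)) : Module.End ℂ (Omega A η) :=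
  LinearMap.pi fun k => match k with
    | 0 => 0
    | k + 1 => T k ∘ₗ LinearMap.proj k

/-- Left multiplication `x ↦ α x` by a 1-form. -/
def leftMul (α : OneForm A η) : Module.End ℂ (Omega A η) :=
  raise fun k =>
    { toFun x := leftProd α x
      map_add' x y := by
        ext v
        simp [leftProd, AlternatingMap.alternatizeUncurryFin_apply,
          Finset.sum_add_distrib]
      map_smul' c x := by
        ext v
        simp [leftProd, AlternatingMap.alternatizeUncurryFin_apply, Finset.smul_sum] }

/-- Right multiplication `x ↦ x α` by a 1-form. -/
def rightMul (α : OneForm A η) : Module.End ℂ (Omega A η) :=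
  raise fun k =>
    { toFun x := rightProd x α
      map_add' x y := by
        ext v
        simp [rightProd, AlternatingMap.alternatizeUncurryFin_apply,
          Finset.sum_add_distrib]
      map_smul' c x := by
        ext v
        simp [rightProd, AlternatingMap.alternatizeUncurryFin_apply, Finset.smul_sum] }

/-- The operator on all forms that applies an `A`- and `ℂ`-linear map to the values. -/
def onValues (f : Val A η →ₗ[A] Val A η) (hf : ∀ (c : ℂ) (u : Val A η), f (c • u) = c • f u) :
    Module.End ℂ (Omega A η) where
  toFun x k := f.compAlternatingMap (x k)
  map_add' x y := by ext; simp
  map_smul' c x := by ext; simp [hf]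

/-- The grading involution of the Clifford algebra, equal to `(-1)^(p+p')` in degree `(p,p')`,
applied to Clifford algebra valued functions, as an `ℝ`-linear map. -/
def involuteValReal : Val A η →ₗ[ℝ] Val A η :=
  LinearMap.rTensor A ((CliffordAlgebra.involute (Q := quad η)).toLinearMap.restrictScalars ℝ)

theorem involuteValReal_tmul (c : Cl η) (a : A) :
    involuteValReal (tmul c a) = tmul (CliffordAlgebra.involute c) a := rfl

/-- The grading involution of the Clifford algebra, applied to Clifford algebra valued
functions. -/
def involuteVal : Val A η →ₗ[A] Val A η where
  toFun := involuteValReal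
  map_add' := map_add _
  map_smul' a u := by
    induction u using val_induction with
    | zero => simp
    | add u v hu hv => rw [smul_add, map_add, hu, hv, map_add, smul_add]
    | tmul c b => simp [smul_tmul, involuteValReal_tmul]

theorem involuteVal_smul (c : ℂ) (u : Val A η) : involuteVal (c • u) = c • involuteVal u := by
  induction u using val_induction with
  | zero => simp
  | add u v hu hv => simp only [smul_add, map_add, hu, hv]
  | tmul e b =>
    change (CliffordAlgebra.involute (c • e)) ⊗ₜ[ℝ] b = (c • CliffordAlgebra.involute e) ⊗ₜ[ℝ] b
    rw [map_smul]

/-- The operator `(-1)^(total degree)` on Clifford forms. -/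
def parity : Module.End ℂ (Omega A η) where
  toFun x k := (-1 : ℂ) ^ k • involuteVal.compAlternatingMap (x k)
  map_add' x y := by ext; simp
  map_smul' c x := by ext; simp [involuteVal_smul, smul_comm c]

/-- The constant function with value `w`, a vector of the complexification. -/
def constVal (A : Type*) [CommRing A] [Algebra ℝ A] (η : LinearMap.BilinForm ℝ V) :
    ℂ ⊗[ℝ] V →ₗ[ℝ] Val A η :=
  (Algebra.TensorProduct.includeLeft : Cl η →ₐ[ℝ] Cl η ⊗[ℝ] A).toLinearMap ∘ₗ
    (CliffordAlgebra.ι (quad η)).restrictScalars ℝ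

/-- Exterior multiplication `w ∧ a = (w a + (-1)^(deg a) a w) / 2` by a vector `w` in the Clifford
algebra. -/
def cliffordWedge (w : ℂ ⊗[ℝ] V) : Module.End ℂ (Omega A η) :=
  onValues
    ((2⁻¹ : ℂ) • (LinearMap.mulLeft A (constVal A η w) +
      LinearMap.mulRight A (constVal A η w) ∘ₗ involuteVal))
    (by intro c u; simp [involuteVal_smul, smul_comm c])

/-- Interior multiplication `w ⊢ a = (w a - (-1)^(deg a) a w) / 2` by a vector `w` in the Clifford
algebra. -/
def cliffordInterior (w : ℂ ⊗[ℝ] V) : Module.End ℂ (Omega A η) :=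
  onValues
    ((2⁻¹ : ℂ) • (LinearMap.mulLeft A (constVal A η w) -
      LinearMap.mulRight A (constVal A η w) ∘ₗ involuteVal))
    (by intro c u; simp [involuteVal_smul, smul_sub, smul_comm c])

/-- Interior multiplication of forms by a vector field, `x ↦ x(X, ·, …, ·)`. -/
def interior (X : Vec A) : Module.End ℂ (Omega A η) where
  toFun x k := (x (k + 1)).curryLeft X
  map_add' x y := by ext; simp
  map_smul' c x := by ext; simp

end Forms

/-! ## Vielbein and complex structure -/

section Vielbein

variable {V : Type*} [AddCommGroup V] [Module ℝ V]

/-- A nondegenerate vielbein: an isomorphism from vector fields to functions with values in `V`,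
linear over functions. -/
abbrev Vielbein (A : Type*) [CommRing A] [Algebra ℝ A] (V : Type*) [AddCommGroup V] [Module ℝ V] :
    Type _ :=
  Vec A ≃ₗ[A] A ⊗[ℝ] V

variable {A : Type*} [CommRing A] [Algebra ℝ A]

/-- The almost complex structure on the tangent bundle induced by `J` and the vielbein. -/
def almostComplex (θ : Vielbein A V) (J : V →ₗ[ℝ] V) : Vec A →ₗ[A] Vec A :=
  θ.symm.toLinearMap ∘ₗ J.baseChange A ∘ₗ θ.toLinearMap

/-- The component `θ` of the vielbein, with values in `V^{1,0}`. -/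
def theta (η : LinearMap.BilinForm ℝ V) (θ : Vielbein A V) (J : V →ₗ[ℝ] V) : OneForm A η :=
  (constVal A η ∘ₗ holPart J).liftBaseChange A ∘ₗ θ.toLinearMap

/-- The component `θ̄` of the vielbein, with values in `V^{0,1}`. -/
def thetaBar (η : LinearMap.BilinForm ℝ V) (θ : Vielbein A V) (J : V →ₗ[ℝ] V) : OneForm A η :=
  (constVal A η ∘ₗ antiholPart J).liftBaseChange A ∘ₗ θ.toLinearMap

variable {η : LinearMap.BilinForm ℝ V}

/-- The functions with values in the component of degree `(p, p')` of the Clifford algebra. -/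
def valType (A : Type*) [CommRing A] [Algebra ℝ A] (η : LinearMap.BilinForm ℝ V) (J : V →ₗ[ℝ] V)
    (p p' : ℕ) : Submodule ℂ (Val A η) :=
  Submodule.span ℂ {u | ∃ c ∈ clType η J p p', ∃ a : A, u = tmul c a}

/-- The space `Ω^{p p' q q'}` of Clifford forms: forms of degree `q + q'` whose values have
Clifford degree `(p, p')` and which satisfy `x(λ v₁, …, λ v_k) = λ^q λ̄^q' x(v₁, …, v_k)` for all
complex numbers `λ` (acting on tangent vectors through the almost complex structure), that is,
which have type `(q, q')`. -/
def OmegaType (θ : Vielbein A V) (η : LinearMap.BilinForm ℝ V) (J : V →ₗ[ℝ] V) (p p' q q' : ℕ) :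
    Submodule ℂ (Omega A η) where
  carrier := {x | (∀ k, k ≠ q + q' → x k = 0) ∧
    (∀ v, x (q + q') v ∈ valType A η J p p') ∧
    ∀ (z : ℂ) (v : Fin (q + q') → Vec A),
      x (q + q') (fun i => z.re • v i + z.im • almostComplex θ J (v i)) =
        (z ^ q * (starRingEnd ℂ z) ^ q') • x (q + q') v}
  zero_mem' := by simp
  add_mem' := by
    rintro x y ⟨hx1, hx2, hx3⟩ ⟨hy1, hy2, hy3⟩
    refine ⟨fun k hk => ?_, fun v => ?_, fun z v => ?_⟩
    · simp [hx1 k hk, hy1 k hk]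
    · exact Submodule.add_mem _ (hx2 v) (hy2 v)
    · simp [hx3, hy3]
  smul_mem' := by
    rintro c x ⟨hx1, hx2, hx3⟩
    refine ⟨fun k hk => ?_, fun v => ?_, fun z v => ?_⟩
    · simp [hx1 k hk]
    · exact Submodule.smul_mem _ c (hx2 v)
    · simp only [Pi.smul_apply, AlternatingMap.smul_apply, hx3]
      rw [smul_comm]

/-! ### The operators `∂` and `∂̄` on 1-forms -/

/-- The `(1,0)`-part of a 1-form. -/
def part10 (θ : Vielbein A V) (J : V →ₗ[ℝ] V) (α : OneForm A η) : OneForm A η :=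
  (2⁻¹ : ℂ) • (α - Complex.I • α ∘ₗ almostComplex θ J)

/-- The `(0,1)`-part of a 1-form. -/
def part01 (θ : Vielbein A V) (J : V →ₗ[ℝ] V) (α : OneForm A η) : OneForm A η :=
  (2⁻¹ : ℂ) • (α + Complex.I • α ∘ₗ almostComplex θ J)

/-- For a 2-form `β`, the 2-form `(X,Y) ↦ β(JX,Y) + β(X,JY)`, written as
`β(X+JX,Y+JY) - β(X,Y) - β(JX,JY)`. -/
def mixed (θ : Vielbein A V) (J : V →ₗ[ℝ] V) (β : Form A η 2) : Form A η 2 :=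
  β.compLinearMap (LinearMap.id + almostComplex θ J) - β - β.compLinearMap (almostComplex θ J)

/-- The `(2,0)`-part of a 2-form, `(β(X,Y) - β(JX,JY) - i β(JX,Y) - i β(X,JY)) / 4`. -/
def part20 (θ : Vielbein A V) (J : V →ₗ[ℝ] V) (β : Form A η 2) : Form A η 2 :=
  (4⁻¹ : ℂ) • (β - β.compLinearMap (almostComplex θ J) - Complex.I • mixed θ J β)

/-- The `(1,1)`-part of a 2-form, `(β(X,Y) + β(JX,JY)) / 2`. -/
def part11 (θ : Vielbein A V) (J : V →ₗ[ℝ] V) (β : Form A η 2) : Form A η 2 :=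
  (2⁻¹ : ℂ) • (β + β.compLinearMap (almostComplex θ J))

/-- The `(0,2)`-part of a 2-form, `(β(X,Y) - β(JX,JY) + i β(JX,Y) + i β(X,JY)) / 4`. -/
def part02 (θ : Vielbein A V) (J : V →ₗ[ℝ] V) (β : Form A η 2) : Form A η 2 :=
  (4⁻¹ : ℂ) • (β - β.compLinearMap (almostComplex θ J) + Complex.I • mixed θ J β)

/-- The operator `∂`, the component of the exterior derivative that raises the type by `(1,0)`. -/
def del (θ : Vielbein A V) (J : V →ₗ[ℝ] V) (α : OneForm A η) : Form A η 2 :=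
  part20 θ J (d (part10 θ J α)) + part11 θ J (d (part01 θ J α))

/-- The operator `∂̄`, the component of the exterior derivative that raises the type by `(0,1)`. -/
def delBar (θ : Vielbein A V) (J : V →ₗ[ℝ] V) (α : OneForm A η) : Form A η 2 :=
  part11 θ J (d (part10 θ J α)) + part02 θ J (d (part01 θ J α))

/-! ### The generators of the affine Lie algebra -/

/-- The operator `x ↦ (α x + (-1)^(deg x) x α) / 2`. -/
def superPlus (α : OneForm A η) : Module.End ℂ (Omega A η) :=
  (2⁻¹ : ℂ) • (leftMul α + rightMul α * parity)

/-- The operator `x ↦ (α x - (-1)^(deg x) x α) / 2`. -/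
def superMinus (α : OneForm A η) : Module.End ℂ (Omega A η) :=
  (2⁻¹ : ℂ) • (leftMul α - rightMul α * parity)

variable [FiniteDimensional ℝ V]

/-- The `a`-th vector `e_a` of a frame: the vector field whose image under the vielbein is the
`a`-th vector `b_a` of a fixed basis of `V`. -/
def frame (θ : Vielbein A V) (a : Fin (Module.finrank ℝ V)) : Vec A :=
  θ.symm (1 ⊗ₜ[ℝ] Module.finBasis ℝ V a)

/-- The vector `b^a` of the `η`-dual basis, `η(b^a, b_c) = δ_{ac}`. -/
def dualVec (hη : η.Nondegenerate) (a : Fin (Module.finrank ℝ V)) : V :=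
  η.dualBasis hη (Module.finBasis ℝ V) a

/-- The operator that multiplies Clifford forms in `Ω^{p p' q q'}` by `p`, that is,
`ξ_i ∂/∂ξ_i ⊗ 1`. -/
def numP (hη : η.Nondegenerate) (J : V →ₗ[ℝ] V) : Module.End ℂ (Omega A η) :=
  ∑ a, cliffordWedge (holPart J (dualVec hη a)) *
    cliffordInterior (1 ⊗ₜ[ℝ] Module.finBasis ℝ V a)

/-- The operator that multiplies Clifford forms in `Ω^{p p' q q'}` by `p'`, that is,
`ξ̄_i ∂/∂ξ̄_i ⊗ 1`. -/
def numPBar (hη : η.Nondegenerate) (J : V →ₗ[ℝ] V) : Module.End ℂ (Omega A η) :=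
  ∑ a, cliffordWedge (antiholPart J (dualVec hη a)) *
    cliffordInterior (1 ⊗ₜ[ℝ] Module.finBasis ℝ V a)

/-- The operator that evaluates the complex multilinear extension of a form `x` on
`∑ᵢ (v₁, …, (vᵢ - c J vᵢ)/2, …, v_k)`. -/
def numForm (η : LinearMap.BilinForm ℝ V) (θ : Vielbein A V) (J : V →ₗ[ℝ] V) (c : ℂ) :
    Module.End ℂ (Omega A η) where
  toFun x
    | 0 => 0
    | k + 1 => AlternatingMap.alternatizeUncurryFin
        ((2⁻¹ : ℂ) • ((x (k + 1)).curryLeft - c • (x (k + 1)).curryLeft ∘ₗ almostComplex θ J))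
  map_add' x y := by
    ext k v
    cases k
    · simp
    · simp only [AlternatingMap.alternatizeUncurryFin_smul, Pi.add_apply, AlternatingMap.add_apply,
        AlternatingMap.smul_apply, AlternatingMap.alternatizeUncurryFin_apply, ← smul_add,
        ← Finset.sum_add_distrib]
      congr 1
      refine Finset.sum_congr rfl fun i _ => ?_
      simp only [LinearMap.sub_apply, LinearMap.smul_apply, LinearMap.comp_apply,
        AlternatingMap.curryLeft_apply_apply, AlternatingMap.sub_apply, AlternatingMap.smul_apply,
        AlternatingMap.add_apply]
      rw [smul_add c]
      congr 1
      abel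
  map_smul' e x := by
    ext k v
    cases k
    · simp
    · simp only [AlternatingMap.alternatizeUncurryFin_smul, Pi.smul_apply,
        AlternatingMap.smul_apply, AlternatingMap.alternatizeUncurryFin_apply, RingHom.id_apply,
        Finset.smul_sum]
      refine Finset.sum_congr rfl fun i _ => ?_
      simp only [LinearMap.sub_apply, LinearMap.smul_apply, LinearMap.comp_apply,
        AlternatingMap.curryLeft_apply_apply, AlternatingMap.sub_apply, AlternatingMap.smul_apply]
      rw [smul_comm c e, ← smul_sub, smul_comm _ e, smul_comm _ e]

/-- The operator that multiplies Clifford forms in `Ω^{p p' q q'}` by `q`, that is,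
`1 ⊗ ξ^i ∂/∂ξ^i`. -/
def numQ (η : LinearMap.BilinForm ℝ V) (θ : Vielbein A V) (J : V →ₗ[ℝ] V) :
    Module.End ℂ (Omega A η) :=
  numForm η θ J Complex.I

/-- The operator that multiplies Clifford forms in `Ω^{p p' q q'}` by `q'`, that is,
`1 ⊗ ξ̄^i ∂/∂ξ̄^i`. -/
def numQBar (η : LinearMap.BilinForm ℝ V) (θ : Vielbein A V) (J : V →ₗ[ℝ] V) :
    Module.End ℂ (Omega A η) :=
  numForm η θ J (-Complex.I)

/-- The generators `E₀ = ξ_i ⊗ ξ^i`, `E₁ = ξ̄_i ⊗ η^{jī} ∂/∂ξ^j`, `E₂ = ∂/∂ξ̄_i ⊗ ∂/∂ξ̄^i`,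
`E₃ = η_{jī} ∂/∂ξ_j ⊗ ξ̄^i`. -/
def genE (hη : η.Nondegenerate) (θ : Vielbein A V) (J : V →ₗ[ℝ] V) :
    Fin 4 → Module.End ℂ (Omega A η) :=
  ![superPlus (theta η θ J),
    ∑ a, cliffordWedge (antiholPart J (dualVec hη a)) * interior (frame θ a),
    ∑ a, cliffordInterior (holPart J (dualVec hη a)) * interior (frame θ a),
    superMinus (thetaBar η θ J)]

/-- The generators `F₀ = ∂/∂ξ_i ⊗ ∂/∂ξ^i`, `F₁ = η_{ij̄} ∂/∂ξ̄_j ⊗ ξ^i`, `F₂ = ξ̄_i ⊗ ξ̄^i`,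
`F₃ = ξ_i ⊗ η^{ij̄} ∂/∂ξ̄^j`. -/
def genF (hη : η.Nondegenerate) (θ : Vielbein A V) (J : V →ₗ[ℝ] V) :
    Fin 4 → Module.End ℂ (Omega A η) :=
  ![∑ a, cliffordInterior (antiholPart J (dualVec hη a)) * interior (frame θ a),
    superMinus (theta η θ J),
    superPlus (thetaBar η θ J),
    ∑ a, cliffordWedge (holPart J (dualVec hη a)) * interior (frame θ a)]

/-- The generators `H_i`; on `Ω^{p p' q q'}` they are multiplication by `p + q - n`, `p' - q`,
`n - p' - q'`, `q' - p`, where `n` is the complex dimension of `V`. -/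
def genH (hη : η.Nondegenerate) (θ : Vielbein A V) (J : V →ₗ[ℝ] V) :
    Fin 4 → Module.End ℂ (Omega A η) :=
  ![numP hη J + numQ η θ J - ((Module.finrank ℝ V : ℂ) / 2) • 1,
    numPBar hη J - numQ η θ J,
    ((Module.finrank ℝ V : ℂ) / 2) • 1 - numPBar hη J - numQBar η θ J,
    numQBar η θ J - numP hη J]

/-- The Lie algebra of operators on Clifford forms generated by all the operators `E_i`, `F_i`,
`H_i`, through which the affine Lie algebra acts. -/
def affineOperators (hη : η.Nondegenerate) (θ : Vielbein A V) (J : V →ₗ[ℝ] V) :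
    LieSubalgebra ℂ (Module.End ℂ (Omega A η)) :=
  LieSubalgebra.lieSpan ℂ _
    (Set.range (genE hη θ J) ∪ Set.range (genF hη θ J) ∪ Set.range (genH hη θ J))

/-- The subalgebra generated by `E₁, F₁, H₁` and `E₃, F₃, H₃`. -/
def kahlerOperators (hη : η.Nondegenerate) (θ : Vielbein A V) (J : V →ₗ[ℝ] V) :
    LieSubalgebra ℂ (Module.End ℂ (Omega A η)) :=
  LieSubalgebra.lieSpan ℂ _
    {genE hη θ J 1, genF hη θ J 1, genH hη θ J 1, genE hη θ J 3, genF hη θ J 3, genH hη θ J 3}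

end Vielbein

/-! ## Manifolds -/

/-- The algebra of smooth real functions on a manifold. -/
abbrev Smooth (E M : Type*) [NormedAddCommGroup E] [NormedSpace ℝ E] [TopologicalSpace M]
    [ChartedSpace E M] : Type _ :=
  ContMDiffMap 𝓘(ℝ, E) 𝓘(ℝ, ℝ) M ℝ ((⊤ : ℕ∞) : WithTop ℕ∞)

end
end CliffordForms

namespace CliffordForms

noncomputable section

/-! ## The complexified vector space -/

section Fibre

variable {V : Type*} [AddCommGroup V] [Module ℝ V]

/-! The argument is algebraic over the algebra `A` of functions. It is the theory of the Riemann
tensor in Clifford terms: the four-index tensor is `R(X,Y;Z,W) = {[R(X,Y), θZ], θW}`, where `R(X,Y)`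
is a bivector of degree `(1,1)`. Three facts make this `contract` behave classically. It is a
central scalar; it is antisymmetric in the last pair because `{θZ, θW}` is central
(`contract_swap`); and it is invariant under `J` in the last pair because `J` acts on `V^{1,0} ∧
V^{0,1}` as `i · (-i) = 1` (`contract_baseChange`). Moreover the bivector can be recovered from its
contractions (`sum_contract_mul`).

Vanishing torsion gives the first Bianchi identity (`bianchi`): the cyclic sum of `[R(X,Y), θZ]` is
zero. With the two antisymmetries it yields the pair symmetry `R(X,Y;Z,W) = R(Z,W;X,Y)`
(`contract_curvature_pair`). Invariance under `J` thus passes from the values to the form arguments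
(`curvature_almostComplex`), so the curvature has form type `(1,1)`. Its formula is then the
`(1,1)`-part of `dω + ω²` (`curvature_eq`).

The operators that annihilate `x` form a Lie subalgebra, so only six generators have to be tested.
`F₁` and `E₃` are half the commutators with `θ` and `θ̄`; these vanish by the Bianchi identity,
split into its two types by the automorphism induced by `J` (`bianchi_theta_thetaBar`). `E₁` and
`F₃` antisymmetrize one form argument with the two value indices; by pair symmetry this is again the
Bianchi identity (`sum_wedge_curvature`), split in the same way. `H₁` and `H₃` vanish because all
four degrees equal one. -/

/-- The complex bilinear extension of `η`. -/
abbrev complexForm (η : LinearMap.BilinForm ℝ V) : LinearMap.BilinForm ℂ (ℂ ⊗[ℝ] V) :=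
  LinearMap.BilinForm.baseChange ℂ η

variable {η : LinearMap.BilinForm ℝ V} {J : V →ₗ[ℝ] V}

theorem complexForm_comm (hsymm : η.IsSymm) (x y : ℂ ⊗[ℝ] V) :
    complexForm η x y = complexForm η y x := by
  induction x using TensorProduct.induction_on with
  | zero => simp
  | add x x' hx hx' => simp only [map_add, LinearMap.add_apply, hx, hx']
  | tmul a v =>
    induction y using TensorProduct.induction_on with
    | zero => simp
    | add y y' hy hy' => simp only [map_add, LinearMap.add_apply, hy, hy']
    | tmul b w =>
      rw [LinearMap.BilinForm.baseChange_tmul, LinearMap.BilinForm.baseChange_tmul, mul_comm a,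
        hsymm.eq w v]

theorem holPart_apply (v : V) :
    holPart J v = (1 / 2 : ℂ) ⊗ₜ[ℝ] v - (Complex.I / 2) ⊗ₜ[ℝ] J v := rfl

theorem antiholPart_apply (v : V) :
    antiholPart J v = (1 / 2 : ℂ) ⊗ₜ[ℝ] v + (Complex.I / 2) ⊗ₜ[ℝ] J v := rfl

theorem holPart_add_antiholPart (v : V) : holPart J v + antiholPart J v = 1 ⊗ₜ[ℝ] v := by
  rw [holPart_apply, antiholPart_apply, sub_add_add_cancel, ← TensorProduct.add_tmul]
  norm_num

theorem I_smul_holPart (hJ : ∀ v, J (J v) = -v) (v : V) :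
    Complex.I • holPart J v = holPart J (J v) := by
  rw [holPart_apply, holPart_apply, smul_sub, TensorProduct.smul_tmul', TensorProduct.smul_tmul',
    hJ, TensorProduct.tmul_neg, sub_neg_eq_add, smul_eq_mul, smul_eq_mul, ← mul_div_assoc,
    ← mul_div_assoc, Complex.I_mul_I, mul_one, neg_div, TensorProduct.neg_tmul, sub_neg_eq_add,
    add_comm]

theorem I_smul_antiholPart (hJ : ∀ v, J (J v) = -v) (v : V) :
    Complex.I • antiholPart J v = -antiholPart J (J v) := by
  rw [antiholPart_apply, antiholPart_apply, smul_add, TensorProduct.smul_tmul',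
    TensorProduct.smul_tmul', hJ, TensorProduct.tmul_neg, smul_eq_mul, smul_eq_mul,
    ← mul_div_assoc, ← mul_div_assoc, Complex.I_mul_I, mul_one, neg_div, TensorProduct.neg_tmul]
  abel

theorem baseChange_holPart (hJ : ∀ v, J (J v) = -v) (v : V) :
    J.baseChange ℂ (holPart J v) = Complex.I • holPart J v := by
  rw [I_smul_holPart hJ, holPart_apply, map_sub, LinearMap.baseChange_tmul,
    LinearMap.baseChange_tmul, holPart_apply]

theorem baseChange_antiholPart (hJ : ∀ v, J (J v) = -v) (v : V) :
    J.baseChange ℂ (antiholPart J v) = -(Complex.I • antiholPart J v) := by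
  rw [I_smul_antiholPart hJ, neg_neg, antiholPart_apply, map_add, LinearMap.baseChange_tmul,
    LinearMap.baseChange_tmul, antiholPart_apply]

theorem complexForm_baseChange (hηJ : ∀ v w, η (J v) (J w) = η v w) (x y : ℂ ⊗[ℝ] V) :
    complexForm η (J.baseChange ℂ x) (J.baseChange ℂ y) = complexForm η x y := by
  induction x using TensorProduct.induction_on with
  | zero => simp
  | add x x' hx hx' => simp only [map_add, LinearMap.add_apply, hx, hx']
  | tmul a v =>
    induction y using TensorProduct.induction_on with
    | zero => simp
    | add y y' hy hy' => simp only [map_add, hy, hy']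
    | tmul b w =>
      simp only [LinearMap.baseChange_tmul, LinearMap.BilinForm.baseChange_tmul, hηJ]

/-- `J` is an isometry and acts as `i` on both arguments, so the value equals its own product with
`i² = -1`. Both eigenspaces are isotropic for this reason. -/
theorem complexForm_holPart_holPart (hJ : ∀ v, J (J v) = -v)
    (hηJ : ∀ v w, η (J v) (J w) = η v w) (v w : V) :
    complexForm η (holPart J v) (holPart J w) = 0 := by
  have h := complexForm_baseChange hηJ (holPart J v) (holPart J w)
  rw [baseChange_holPart hJ, baseChange_holPart hJ, LinearMap.map_smul₂, map_smul,
    smul_smul, Complex.I_mul_I, neg_one_smul] at h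
  exact self_eq_neg.1 h.symm

theorem complexForm_antiholPart_antiholPart (hJ : ∀ v, J (J v) = -v)
    (hηJ : ∀ v w, η (J v) (J w) = η v w) (v w : V) :
    complexForm η (antiholPart J v) (antiholPart J w) = 0 := by
  have h := complexForm_baseChange hηJ (antiholPart J v) (antiholPart J w)
  rw [baseChange_antiholPart hJ, baseChange_antiholPart hJ, ← neg_smul, ← neg_smul,
    LinearMap.map_smul₂, map_smul, smul_smul, neg_mul_neg, Complex.I_mul_I, neg_one_smul] at h
  exact self_eq_neg.1 h.symm

theorem holSpace_eq_span (hJ : ∀ v, J (J v) = -v) :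
    holSpace J = Submodule.span ℂ (Set.range (holPart J)) := by
  apply le_antisymm
  -- The projection `(1 - iJ)/2` sends a pure tensor `a ⊗ v` to `a • holPart J v`, and it fixes
  -- every vector of the eigenspace.
  · have key : ∀ x : ℂ ⊗[ℝ] V, (1 / 2 : ℂ) • x - (Complex.I / 2) • J.baseChange ℂ x ∈
        Submodule.span ℂ (Set.range (holPart J)) := by
      intro x
      induction x using TensorProduct.induction_on with
      | zero => simp
      | add x y hx hy =>
        convert add_mem hx hy using 1
        simp only [map_add, smul_add]
        abel
      | tmul a v =>
        convert Submodule.smul_mem _ a (Submodule.subset_span (Set.mem_range_self v)) using 1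
        rw [holPart_apply, LinearMap.baseChange_tmul, smul_sub]
        simp only [TensorProduct.smul_tmul', smul_eq_mul, mul_comm a]
    intro x hx
    have hx' : J.baseChange ℂ x = Complex.I • x := Module.End.mem_eigenspace_iff.1 hx
    have h := key x
    rw [hx', smul_smul, ← sub_smul] at h
    convert h using 1
    rw [div_mul_eq_mul_div, Complex.I_mul_I]
    norm_num
  · rw [Submodule.span_le]
    rintro _ ⟨v, rfl⟩
    exact Module.End.mem_eigenspace_iff.2 (baseChange_holPart hJ v)

theorem antiholSpace_eq_span (hJ : ∀ v, J (J v) = -v) :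
    antiholSpace J = Submodule.span ℂ (Set.range (antiholPart J)) := by
  apply le_antisymm
  · have key : ∀ x : ℂ ⊗[ℝ] V, (1 / 2 : ℂ) • x + (Complex.I / 2) • J.baseChange ℂ x ∈
        Submodule.span ℂ (Set.range (antiholPart J)) := by
      intro x
      induction x using TensorProduct.induction_on with
      | zero => simp
      | add x y hx hy =>
        convert add_mem hx hy using 1
        simp only [map_add, smul_add]
        abel
      | tmul a v =>
        convert Submodule.smul_mem _ a (Submodule.subset_span (Set.mem_range_self v)) using 1
        rw [antiholPart_apply, LinearMap.baseChange_tmul, smul_add]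
        simp only [TensorProduct.smul_tmul', smul_eq_mul, mul_comm a]
    intro x hx
    have hx' : J.baseChange ℂ x = (-Complex.I) • x := Module.End.mem_eigenspace_iff.1 hx
    have h := key x
    rw [hx', smul_smul, ← add_smul] at h
    convert h using 1
    rw [div_mul_eq_mul_div, mul_neg, Complex.I_mul_I]
    norm_num
  · rw [Submodule.span_le]
    rintro _ ⟨v, rfl⟩
    exact Module.End.mem_eigenspace_iff.2 ((baseChange_antiholPart hJ v).trans (neg_smul _ _).symm)

/-! ### Bivectors in the Clifford algebra -/

theorem ι_mul_ι_add_swap_eq (hsymm : η.IsSymm) (x y : ℂ ⊗[ℝ] V) :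
    CliffordAlgebra.ι (quad η) x * CliffordAlgebra.ι (quad η) y +
      CliffordAlgebra.ι (quad η) y * CliffordAlgebra.ι (quad η) x =
      algebraMap ℂ (Cl η) (2 * complexForm η x y) := by
  rw [CliffordAlgebra.ι_mul_ι_add_swap, LinearMap.BilinMap.polar_toQuadraticMap,
    complexForm_comm hsymm y x, two_mul]

/-- The exterior product `x ∧ y = (x y - y x) / 2` of two vectors in the Clifford algebra. -/
def bivector (η : LinearMap.BilinForm ℝ V) (x y : ℂ ⊗[ℝ] V) : Cl η :=
  (2⁻¹ : ℂ) • (CliffordAlgebra.ι (quad η) x * CliffordAlgebra.ι (quad η) y -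
    CliffordAlgebra.ι (quad η) y * CliffordAlgebra.ι (quad η) x)

/-- Changing the form alters a product of two vectors by a scalar that is symmetric in them; the
scalar drops out of the antisymmetrized product. -/
theorem equivExterior_bivector (x y : ℂ ⊗[ℝ] V) :
    CliffordAlgebra.equivExterior (quad η) (bivector η x y) =
      ExteriorAlgebra.ι ℂ x * ExteriorAlgebra.ι ℂ y := by
  have h : ExteriorAlgebra.ι ℂ y * ExteriorAlgebra.ι ℂ x =
      -(ExteriorAlgebra.ι ℂ x * ExteriorAlgebra.ι ℂ y) :=
    eq_neg_of_add_eq_zero_left (ExteriorAlgebra.ι_add_mul_swap y x)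
  rw [bivector, map_smul, map_sub, CliffordAlgebra.equivExterior,
    CliffordAlgebra.changeFormEquiv_apply,
    CliffordAlgebra.changeFormEquiv_apply,
    CliffordAlgebra.changeForm_ι_mul_ι, CliffordAlgebra.changeForm_ι_mul_ι]
  change (2⁻¹ : ℂ) • ((ExteriorAlgebra.ι ℂ x * ExteriorAlgebra.ι ℂ y - _) -
    (ExteriorAlgebra.ι ℂ y * ExteriorAlgebra.ι ℂ x - _)) = _
  rw [h, QuadraticMap.associated_isSymm ℂ (-quad η) y x]
  module

/-- Replaces the definition through the exterior algebra by explicit Clifford elements, on which all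
later computations are done. -/
theorem clType_one_one (hJ : ∀ v, J (J v) = -v) :
    clType η J 1 1 = Submodule.span ℂ
      {c | ∃ v w, c = bivector η (holPart J v) (antiholPart J w)} := by
  rw [clType, pow_one, pow_one, holSpace_eq_span hJ, antiholSpace_eq_span hJ, Submodule.map_span,
    Submodule.map_span, Submodule.span_mul_span]
  have e := Submodule.map_equiv_eq_comap_symm (CliffordAlgebra.equivExterior (quad η)).symm
  rw [LinearEquiv.symm_symm] at e
  erw [← e]
  rw [Submodule.map_span]
  congr 1
  ext c
  constructor
  · rintro ⟨_, ⟨_, ⟨_, ⟨v, rfl⟩, rfl⟩, _, ⟨_, ⟨w, rfl⟩, rfl⟩, rfl⟩, rfl⟩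
    refine ⟨v, w, ?_⟩
    exact (LinearEquiv.symm_apply_eq _).2 (equivExterior_bivector _ _).symm
  · rintro ⟨v, w, rfl⟩
    refine ⟨_, ⟨_, ⟨_, ⟨v, rfl⟩, rfl⟩, _, ⟨_, ⟨w, rfl⟩, rfl⟩, rfl⟩, ?_⟩
    exact (LinearEquiv.symm_apply_eq _).2 (equivExterior_bivector _ _).symm

/-- The automorphism of the Clifford algebra induced by `J`. -/
def mapJ (η : LinearMap.BilinForm ℝ V) (J : V →ₗ[ℝ] V)
    (hηJ : ∀ v w, η (J v) (J w) = η v w) : Cl η →ₐ[ℂ] Cl η :=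
  CliffordAlgebra.map
    { J.baseChange ℂ with map_app' := fun x => complexForm_baseChange hηJ x x }

theorem mapJ_ι (hηJ : ∀ v w, η (J v) (J w) = η v w) (x : ℂ ⊗[ℝ] V) :
    mapJ η J hηJ (CliffordAlgebra.ι (quad η) x) = CliffordAlgebra.ι (quad η) (J.baseChange ℂ x) :=
  CliffordAlgebra.map_apply_ι _ _

/-! ### Expansion in the `η`-dual basis -/

section Dual

variable [FiniteDimensional ℝ V]

theorem sum_smul_dualVec (hη : η.Nondegenerate) (v : V) :
    ∑ a, η v (Module.finBasis ℝ V a) • dualVec hη a = v := by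
  conv_rhs => rw [← (η.dualBasis hη (Module.finBasis ℝ V)).sum_repr v]
  simp only [LinearMap.BilinForm.dualBasis_repr_apply]
  rfl

/-- The expansion `x = ∑ η(x, b_a) b^a` pushed through `f`. The map is left arbitrary because it is
needed both for vectors and for bivectors in the Clifford algebra. -/
theorem sum_complexForm_smul (hη : η.Nondegenerate) (x : ℂ ⊗[ℝ] V)
    {W : Type*} [AddCommGroup W] [Module ℂ W] (f : ℂ ⊗[ℝ] V →ₗ[ℂ] W) :
    ∑ a, complexForm η x (1 ⊗ₜ[ℝ] Module.finBasis ℝ V a) • f (1 ⊗ₜ[ℝ] dualVec hη a) = f x := by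
  induction x using TensorProduct.induction_on with
  | zero => simp
  | add x y hx hy =>
    simp only [map_add, LinearMap.add_apply, add_smul, Finset.sum_add_distrib, hx, hy]
  | tmul z v =>
    conv_rhs => rw [← sum_smul_dualVec hη v, TensorProduct.tmul_sum, map_sum]
    refine Finset.sum_congr rfl fun a _ => ?_
    rw [LinearMap.BilinForm.baseChange_tmul, mul_one, ← map_smul, TensorProduct.smul_tmul',
      TensorProduct.tmul_smul, TensorProduct.smul_tmul', smul_eq_mul, mul_one]

end Dual

end Fibre

/-! ## Clifford algebra valued functions -/

/-! ### Commutators of bivectors with vectors and with each other -/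

section Bivectors

variable {V : Type*} [AddCommGroup V] [Module ℝ V]
variable {η : LinearMap.BilinForm ℝ V} {J : V →ₗ[ℝ] V}

theorem bivector_mul_ι_sub (hsymm : η.IsSymm) (x y z : ℂ ⊗[ℝ] V) :
    bivector η x y * CliffordAlgebra.ι (quad η) z - CliffordAlgebra.ι (quad η) z * bivector η x y =
      (2 * complexForm η y z) • CliffordAlgebra.ι (quad η) x -
        (2 * complexForm η x z) • CliffordAlgebra.ι (quad η) y := by
  have hyz := ι_mul_ι_add_swap_eq hsymm y z
  have hxz := ι_mul_ι_add_swap_eq hsymm x z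
  rw [bivector, smul_mul_assoc, mul_smul_comm, ← smul_sub]
  generalize CliffordAlgebra.ι (quad η) x = X at *
  generalize CliffordAlgebra.ι (quad η) y = Y at *
  generalize CliffordAlgebra.ι (quad η) z = Z at *
  -- The commutator is expressed through the anticommutators `{Y,Z}` and `{X,Z}` alone, which are
  -- scalars.
  have e : (X * Y - Y * X) * Z - Z * (X * Y - Y * X) =
      X * (Y * Z + Z * Y) - (X * Z + Z * X) * Y - Y * (X * Z + Z * X) + (Y * Z + Z * Y) * X := by
    noncomm_ring
  rw [e, hyz, hxz, ← Algebra.commutes, ← Algebra.commutes _ Y]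
  simp only [← Algebra.smul_def]
  module

/-- The scalar `{[x ∧ y, z], t}` obtained by contracting a bivector with two vectors. -/
theorem bivector_contract (hsymm : η.IsSymm) (x y z t : ℂ ⊗[ℝ] V) :
    (bivector η x y * CliffordAlgebra.ι (quad η) z - CliffordAlgebra.ι (quad η) z * bivector η x y) *
        CliffordAlgebra.ι (quad η) t +
      CliffordAlgebra.ι (quad η) t * (bivector η x y * CliffordAlgebra.ι (quad η) z -
        CliffordAlgebra.ι (quad η) z * bivector η x y) =
      algebraMap ℂ (Cl η) (4 * (complexForm η y z * complexForm η x t -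
        complexForm η x z * complexForm η y t)) := by
  have hxt := ι_mul_ι_add_swap_eq hsymm x t
  have hyt := ι_mul_ι_add_swap_eq hsymm y t
  rw [bivector_mul_ι_sub hsymm, sub_mul, mul_sub, smul_mul_assoc, smul_mul_assoc, mul_smul_comm,
    mul_smul_comm, sub_add_sub_comm, ← smul_add, ← smul_add, hxt, hyt, Algebra.smul_def,
    Algebra.smul_def, ← map_mul, ← map_mul, ← map_sub]
  congr 1
  ring

theorem bivector_mul_bivector_sub (hsymm : η.IsSymm) (x y z t : ℂ ⊗[ℝ] V) :
    bivector η x y * bivector η z t - bivector η z t * bivector η x y =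
      (2 * complexForm η y z) • bivector η x t - (2 * complexForm η x z) • bivector η y t +
      (2 * complexForm η y t) • bivector η z x - (2 * complexForm η x t) • bivector η z y := by
  have hz := bivector_mul_ι_sub hsymm x y z
  have ht := bivector_mul_ι_sub hsymm x y t
  unfold bivector at hz ht ⊢
  generalize CliffordAlgebra.ι (quad η) x = X at *
  generalize CliffordAlgebra.ι (quad η) y = Y at *
  generalize CliffordAlgebra.ι (quad η) z = Z at *
  generalize CliffordAlgebra.ι (quad η) t = T at *
  generalize (2⁻¹ : ℂ) • (X * Y - Y * X) = W at *
  -- The Leibniz rule for the derivation `[W, ·]`; it reduces the claim to the action of a bivector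
  -- on single vectors.
  have e : W * ((2⁻¹ : ℂ) • (Z * T - T * Z)) - ((2⁻¹ : ℂ) • (Z * T - T * Z)) * W =
      (2⁻¹ : ℂ) • ((W * Z - Z * W) * T - T * (W * Z - Z * W) +
        (Z * (W * T - T * W) - (W * T - T * W) * Z)) := by
    rw [smul_mul_assoc, mul_smul_comm, ← smul_sub]
    congr 1
    noncomm_ring
  rw [e, hz, ht]
  simp only [sub_mul, mul_sub, smul_mul_assoc, mul_smul_comm]
  module

theorem mapJ_bivector (hηJ : ∀ v w, η (J v) (J w) = η v w) (x y : ℂ ⊗[ℝ] V) :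
    mapJ η J hηJ (bivector η x y) =
      bivector η (J.baseChange ℂ x) (J.baseChange ℂ y) := by
  rw [bivector, map_smul, map_sub, map_mul, map_mul, mapJ_ι, mapJ_ι, bivector]

theorem involute_bivector (x y : ℂ ⊗[ℝ] V) :
    CliffordAlgebra.involute (bivector η x y) = bivector η x y := by
  rw [bivector, map_smul, map_sub, map_mul, map_mul, CliffordAlgebra.involute_ι,
    CliffordAlgebra.involute_ι, neg_mul_neg, neg_mul_neg]

/-- Multiplication by `i` on `V^{1,0}` is `J` on `V`, so a complex factor is absorbed by the real
vector. This lets the induction principle for degree `(1,1)` do without a case for complex scalars.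
-/
theorem smul_bivector_holPart (hJ : ∀ v, J (J v) = -v) (c : ℂ) (v w : V) :
    c • bivector η (holPart J v) (antiholPart J w) =
      bivector η (holPart J (c.re • v + c.im • J v)) (antiholPart J w) := by
  have h : holPart J (c.re • v + c.im • J v) = c • holPart J v := by
    rw [map_add, LinearMap.map_smul, LinearMap.map_smul, ← I_smul_holPart hJ]
    conv_rhs => rw [← Complex.re_add_im c, add_smul, mul_smul]
    rfl
  rw [h, bivector, bivector, map_smul, smul_comm, smul_mul_assoc, mul_smul_comm, smul_sub c]

end Bivectors

section Val

variable {V : Type*} [AddCommGroup V] [Module ℝ V]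
variable {A : Type*} [CommRing A] [Algebra ℝ A]
variable {η : LinearMap.BilinForm ℝ V} {J : V →ₗ[ℝ] V}

/-- The constant Clifford algebra valued functions. -/
def constCl (A : Type*) [CommRing A] [Algebra ℝ A] (η : LinearMap.BilinForm ℝ V) :
    Cl η →ₐ[ℂ] Val A η :=
  (Algebra.TensorProduct.includeLeft : Cl η →ₐ[ℂ] Cl η ⊗[ℝ] A)

theorem constCl_ι (x : ℂ ⊗[ℝ] V) :
    constCl A η (CliffordAlgebra.ι (quad η) x) = constVal A η x := rfl

theorem tmul_eq_smul (c : Cl η) (a : A) : tmul c a = a • constCl A η c :=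
  ((smul_tmul a 1 c).trans (by rw [mul_one])).symm

theorem smul_smul_comm_val (c : ℂ) (a : A) (u : Val A η) : c • a • u = a • c • u :=
  smul_comm c a u

theorem constVal_smul (c : ℂ) (x : ℂ ⊗[ℝ] V) : constVal A η (c • x) = c • constVal A η x := by
  rw [← constCl_ι, map_smul, map_smul, constCl_ι]

theorem lieVal_constCl (X : Vec A) (c : Cl η) : lieVal X (constCl A η c) = 0 := by
  have h : constCl A η c = tmul c 1 := rfl
  rw [h, lieVal_tmul, Derivation.map_one_eq_zero]
  exact TensorProduct.tmul_zero _ _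

theorem lieVal_smul_constCl (X : Vec A) (a : A) (c : Cl η) :
    lieVal X (a • constCl A η c) = X a • constCl A η c := by
  rw [lieVal_smul, lieVal_constCl, smul_zero, zero_add]

/-- Induction on Clifford algebra valued functions, in terms of constant functions. -/
theorem val_induction_smul {motive : Val A η → Prop} (u : Val A η)
    (smul : ∀ (a : A) c, motive (a • constCl A η c))
    (add : ∀ u v, motive u → motive v → motive (u + v)) : motive u := by
  induction u using val_induction with
  | zero => simpa using smul 0 0
  | tmul c a => rw [tmul_eq_smul]; exact smul a c
  | add u v hu hv => exact add u v hu hv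

theorem smul_constCl_mul (a b : A) (c e : Cl η) :
    (a • constCl A η c) * (b • constCl A η e) = (a * b) • constCl A η (c * e) := by
  rw [smul_mul_smul_comm, map_mul]

theorem lieVal_mul (X : Vec A) (u v : Val A η) :
    lieVal X (u * v) = lieVal X u * v + u * lieVal X v := by
  induction u using val_induction_smul with
  | add u u' hu hu' => simp only [map_add, add_mul, hu, hu']; abel
  | smul a c =>
    induction v using val_induction_smul with
    | add v v' hv hv' => simp only [map_add, mul_add, hv, hv']; abel
    | smul b e =>
      simp only [smul_constCl_mul, lieVal_smul_constCl, Derivation.leibniz, smul_eq_mul, add_smul]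
      rw [add_comm, mul_comm b]

theorem lieVal_lie (X Y : Vec A) (u : Val A η) :
    lieVal ⁅X, Y⁆ u = lieVal X (lieVal Y u) - lieVal Y (lieVal X u) := by
  induction u using val_induction_smul with
  | add u u' hu hu' => simp only [map_add, hu, hu']; abel
  | smul a c => simp only [lieVal_smul_constCl, Derivation.commutator_apply, sub_smul]

/-- The automorphism of the algebra of Clifford algebra valued functions induced by `J`, as an
algebra homomorphism over the real numbers. -/
def mapJVal (A : Type*) [CommRing A] [Algebra ℝ A] (hηJ : ∀ v w, η (J v) (J w) = η v w) :
    Val A η →ₐ[ℝ] Val A η :=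
  (Algebra.TensorProduct.map ((mapJ η J hηJ).restrictScalars ℝ) (AlgHom.id ℝ A) :
    Cl η ⊗[ℝ] A →ₐ[ℝ] Cl η ⊗[ℝ] A)

theorem mapJVal_smul_constCl (hηJ : ∀ v w, η (J v) (J w) = η v w) (a : A) (c : Cl η) :
    mapJVal A hηJ (a • constCl A η c) = a • constCl A η (mapJ η J hηJ c) := by
  rw [← tmul_eq_smul, ← tmul_eq_smul]
  rfl

theorem mapJVal_smul (hηJ : ∀ v w, η (J v) (J w) = η v w) (a : A) (u : Val A η) :
    mapJVal A hηJ (a • u) = a • mapJVal A hηJ u := by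
  induction u using val_induction_smul with
  | add u u' hu hu' => simp only [map_add, smul_add, hu, hu']
  | smul b c => simp only [smul_smul, mapJVal_smul_constCl]

theorem mapJVal_constVal (hηJ : ∀ v w, η (J v) (J w) = η v w) (x : ℂ ⊗[ℝ] V) :
    mapJVal A hηJ (constVal A η x) = constVal A η (J.baseChange ℂ x) := by
  have h := mapJVal_smul_constCl (A := A) hηJ 1 (CliffordAlgebra.ι (quad η) x)
  rwa [one_smul, one_smul, mapJ_ι] at h

theorem involuteVal_smul_constCl (a : A) (c : Cl η) :
    involuteVal (a • constCl A η c) = a • constCl A η (CliffordAlgebra.involute c) := by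
  rw [map_smul]
  rfl

/-! ### Functions with values in the component of degree `(1, 1)` -/

theorem smul_bivector_mem_valType (hJ : ∀ v, J (J v) = -v) (a : A) (v w : V) :
    a • constCl A η (bivector η (holPart J v) (antiholPart J w)) ∈ valType A η J 1 1 := by
  refine Submodule.subset_span ⟨_, ?_, a, (tmul_eq_smul _ a).symm⟩
  rw [clType_one_one hJ]
  exact Submodule.subset_span ⟨v, w, rfl⟩

@[elab_as_elim]
theorem valType_one_one_induction (hJ : ∀ v, J (J v) = -v)
    {motive : (u : Val A η) → u ∈ valType A η J 1 1 → Prop}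
    (bivector : ∀ (a : A) v w,
      motive (a • constCl A η (bivector η (holPart J v) (antiholPart J w)))
        (smul_bivector_mem_valType hJ a v w))
    (add : ∀ u v hu hv, motive u hu → motive v hv → motive (u + v) (add_mem hu hv))
    {u : Val A η} (hu : u ∈ valType A η J 1 1) : motive u hu := by
  have zero : motive 0 (zero_mem _) := by simpa using bivector 0 0 0
  suffices h : ∃ h, motive u h from h.2
  refine Submodule.closure_induction (p := fun u _ => ∃ h, motive u h) ⟨_, zero⟩
    (fun u v _ _ hu hv => ⟨_, add u v _ _ hu.2 hv.2⟩) ?_ hu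
  rintro z _ ⟨c, hc, a, rfl⟩
  rw [tmul_eq_smul, smul_smul_comm_val, ← map_smul]
  rw [clType_one_one hJ] at hc
  have hc' := Submodule.smul_mem _ z hc
  generalize z • c = e at hc'
  refine Submodule.closure_induction (p := fun e _ => ∃ h, motive (a • constCl A η e) h)
    ⟨by simp, by simpa using zero⟩ (fun u v _ _ hu hv => ?_) ?_ hc'
  · rw [map_add, smul_add]
    exact ⟨_, add _ _ _ _ hu.2 hv.2⟩
  · rintro z _ ⟨v, w, rfl⟩
    rw [smul_bivector_holPart hJ]
    exact ⟨_, bivector _ _ _⟩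

theorem lieVal_mem_valType (hJ : ∀ v, J (J v) = -v) (X : Vec A) {u : Val A η}
    (hu : u ∈ valType A η J 1 1) : lieVal X u ∈ valType A η J 1 1 := by
  induction hu using valType_one_one_induction hJ with
  | add u v _ _ hu hv => rw [map_add]; exact add_mem hu hv
  | bivector b v w => rw [lieVal_smul_constCl]; exact smul_bivector_mem_valType hJ _ _ _

theorem involuteVal_of_mem_valType (hJ : ∀ v, J (J v) = -v) {u : Val A η}
    (hu : u ∈ valType A η J 1 1) : involuteVal u = u := by
  induction hu using valType_one_one_induction hJ with
  | add u v _ _ hu hv => rw [map_add, hu, hv]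
  | bivector b v w => rw [involuteVal_smul_constCl, involute_bivector]

/-- One factor contributes `i` and the other `-i`, with product one. Every later separation of an
identity into its `V^{1,0}` and `V^{0,1}` parts uses this invariance. -/
theorem mapJVal_of_mem_valType (hJ : ∀ v, J (J v) = -v) (hηJ : ∀ v w, η (J v) (J w) = η v w)
    {u : Val A η} (hu : u ∈ valType A η J 1 1) : mapJVal A hηJ u = u := by
  induction hu using valType_one_one_induction hJ with
  | add u v _ _ hu hv => rw [map_add, hu, hv]
  | bivector b v w =>
    have h : ∀ x y : ℂ ⊗[ℝ] V, bivector η (Complex.I • x) (-(Complex.I • y)) = bivector η x y := by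
      intro x y
      rw [bivector, bivector, map_neg, LinearMap.map_smul, LinearMap.map_smul, mul_neg, neg_mul,
        smul_mul_smul_comm, smul_mul_smul_comm, Complex.I_mul_I, neg_one_smul, neg_one_smul,
        neg_neg, neg_neg]
    rw [mapJVal_smul_constCl, mapJ_bivector, baseChange_holPart hJ, baseChange_antiholPart hJ, h]

/-- In the commutator of two bivectors, the terms of degree `(2,0)` and `(0,2)` carry the factors
`η(V^{0,1}, V^{0,1})` and `η(V^{1,0}, V^{1,0})`, which are zero. -/
theorem mul_sub_mul_mem_valType (hsymm : η.IsSymm) (hJ : ∀ v, J (J v) = -v)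
    (hηJ : ∀ v w, η (J v) (J w) = η v w) {u u' : Val A η} (hu : u ∈ valType A η J 1 1)
    (hu' : u' ∈ valType A η J 1 1) : u * u' - u' * u ∈ valType A η J 1 1 := by
  induction hu using valType_one_one_induction hJ with
  | add u v _ _ hu hv =>
    convert add_mem hu hv using 1
    noncomm_ring
  | bivector a v w =>
    induction hu' using valType_one_one_induction hJ with
    | add u v _ _ hu hv =>
      convert add_mem hu hv using 1
      rw [mul_add, add_mul]
      abel
    | bivector b v' w' =>
      rw [smul_constCl_mul, smul_constCl_mul, mul_comm b, ← smul_sub, ← map_sub,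
        bivector_mul_bivector_sub hsymm, complexForm_holPart_holPart hJ hηJ,
        complexForm_antiholPart_antiholPart hJ hηJ, mul_zero, zero_smul, zero_smul, sub_zero,
        add_zero, map_sub, map_smul, map_smul, smul_sub, ← smul_smul_comm_val,
        ← smul_smul_comm_val]
      exact sub_mem (Submodule.smul_mem _ _ (smul_bivector_mem_valType hJ _ _ _))
        (Submodule.smul_mem _ _ (smul_bivector_mem_valType hJ _ _ _))

end Val

/-! ## Vector valued functions and contractions -/

section Contract

variable {V : Type*} [AddCommGroup V] [Module ℝ V]
variable {A : Type*} [CommRing A] [Algebra ℝ A]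
variable {η : LinearMap.BilinForm ℝ V} {J : V →ₗ[ℝ] V}

/-- The embedding of functions with values in `V` into Clifford algebra valued functions. -/
def vecVal (A : Type*) [CommRing A] [Algebra ℝ A] (η : LinearMap.BilinForm ℝ V) :
    A ⊗[ℝ] V →ₗ[A] Val A η :=
  (constVal A η ∘ₗ TensorProduct.mk ℝ ℂ V 1).liftBaseChange A

theorem vecVal_tmul (a : A) (v : V) :
    vecVal A η (a ⊗ₜ[ℝ] v) = a • constCl A η (CliffordAlgebra.ι (quad η) (1 ⊗ₜ[ℝ] v)) :=
  LinearMap.liftBaseChange_tmul _ _ _ _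

theorem vecVal_one_tmul (v : V) : vecVal A η (1 ⊗ₜ[ℝ] v) = constVal A η (1 ⊗ₜ[ℝ] v) := by
  rw [vecVal_tmul, one_smul, constCl_ι]

theorem mapJVal_vecVal (hηJ : ∀ v w, η (J v) (J w) = η v w) (s : A ⊗[ℝ] V) :
    mapJVal A hηJ (vecVal A η s) = vecVal A η (J.baseChange A s) := by
  induction s using TensorProduct.induction_on with
  | zero => simp
  | add s t hs ht => simp only [map_add, hs, ht]
  | tmul a v =>
    rw [vecVal_tmul, mapJVal_smul_constCl, mapJ_ι, LinearMap.baseChange_tmul,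
      LinearMap.baseChange_tmul, vecVal_tmul]

theorem smul_constCl_algebraMap_mul_comm (a : A) (c : ℂ) (u : Val A η) :
    (a • constCl A η (algebraMap ℂ (Cl η) c)) * u =
      u * (a • constCl A η (algebraMap ℂ (Cl η) c)) := by
  rw [AlgHom.commutes, smul_mul_assoc, mul_smul_comm, Algebra.commutes]

theorem vecVal_anticomm_mul_comm (hsymm : η.IsSymm) (s t : A ⊗[ℝ] V) (u : Val A η) :
    (vecVal A η s * vecVal A η t + vecVal A η t * vecVal A η s) * u =
      u * (vecVal A η s * vecVal A η t + vecVal A η t * vecVal A η s) := by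
  induction s using TensorProduct.induction_on with
  | zero => simp
  | add s s' hs hs' =>
    have e : vecVal A η (s + s') * vecVal A η t + vecVal A η t * vecVal A η (s + s') =
        (vecVal A η s * vecVal A η t + vecVal A η t * vecVal A η s) +
        (vecVal A η s' * vecVal A η t + vecVal A η t * vecVal A η s') := by
      rw [map_add]
      noncomm_ring
    rw [e, add_mul, mul_add, hs, hs']
  | tmul a v =>
    induction t using TensorProduct.induction_on with
    | zero => simp
    | add t t' ht ht' =>
      generalize vecVal A η (a ⊗ₜ[ℝ] v) = x at *
      have e : x * vecVal A η (t + t') + vecVal A η (t + t') * x =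
          (x * vecVal A η t + vecVal A η t * x) + (x * vecVal A η t' + vecVal A η t' * x) := by
        rw [map_add]
        noncomm_ring
      rw [e, add_mul, mul_add, ht, ht']
    | tmul b w =>
      rw [vecVal_tmul, vecVal_tmul, smul_constCl_mul, smul_constCl_mul, mul_comm b, ← smul_add,
        ← map_add, ι_mul_ι_add_swap_eq hsymm, smul_constCl_algebraMap_mul_comm]

/-- The contraction `{[u, s], t}` of a Clifford algebra valued function with two vector valued
functions. -/
def contract (u : Val A η) (s t : A ⊗[ℝ] V) : Val A η :=
  (u * vecVal A η s - vecVal A η s * u) * vecVal A η t +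
    vecVal A η t * (u * vecVal A η s - vecVal A η s * u)

theorem contract_add (u u' : Val A η) (s t : A ⊗[ℝ] V) :
    contract (u + u') s t = contract u s t + contract u' s t := by
  unfold contract
  noncomm_ring

theorem contract_neg (u : Val A η) (s t : A ⊗[ℝ] V) :
    contract (-u) s t = -contract u s t := by
  unfold contract
  noncomm_ring

theorem contract_sub (u u' : Val A η) (s t : A ⊗[ℝ] V) :
    contract (u - u') s t = contract u s t - contract u' s t := by
  rw [sub_eq_add_neg, contract_add, contract_neg, sub_eq_add_neg]

/-- The sum `{[u,s],t} + {[u,t],s}` is `[u,{s,t}]`, and `{s,t}` is central. -/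
theorem contract_swap (hsymm : η.IsSymm) (u : Val A η) (s t : A ⊗[ℝ] V) :
    contract u t s = -contract u s t := by
  have h := vecVal_anticomm_mul_comm hsymm s t u
  rw [eq_neg_iff_add_eq_zero, ← sub_eq_zero.2 h.symm]
  unfold contract
  noncomm_ring

theorem contract_smul_constCl (a b e : A) (c : Cl η) (v w : V) :
    contract (a • constCl A η c) (b ⊗ₜ[ℝ] v) (e ⊗ₜ[ℝ] w) = (a * b * e) • constCl A η
      ((c * CliffordAlgebra.ι (quad η) (1 ⊗ₜ[ℝ] v) - CliffordAlgebra.ι (quad η) (1 ⊗ₜ[ℝ] v) * c) *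
          CliffordAlgebra.ι (quad η) (1 ⊗ₜ[ℝ] w) +
        CliffordAlgebra.ι (quad η) (1 ⊗ₜ[ℝ] w) *
          (c * CliffordAlgebra.ι (quad η) (1 ⊗ₜ[ℝ] v) -
            CliffordAlgebra.ι (quad η) (1 ⊗ₜ[ℝ] v) * c)) := by
  rw [contract, vecVal_tmul, vecVal_tmul, smul_constCl_mul, smul_constCl_mul, mul_comm b a,
    ← smul_sub, ← map_sub, smul_constCl_mul, smul_constCl_mul, mul_comm e, ← smul_add, ← map_add]

/-- Contractions of functions of degree `(1, 1)` are sums of multiples of scalars. -/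
theorem contract_induction (hsymm : η.IsSymm) (hJ : ∀ v, J (J v) = -v) {motive : Val A η → Prop}
    {u : Val A η} (hu : u ∈ valType A η J 1 1) (s t : A ⊗[ℝ] V)
    (scalar : ∀ (a : A) c, motive (a • constCl A η (algebraMap ℂ (Cl η) c)))
    (add : ∀ x y, motive x → motive y → motive (x + y)) : motive (contract u s t) := by
  have zero : motive 0 := by simpa using scalar 0 0
  induction hu using valType_one_one_induction hJ with
  | add u v _ _ hu hv => rw [contract_add]; exact add _ _ hu hv
  | bivector a v w =>
    induction s using TensorProduct.induction_on with
    | zero =>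
      convert zero
      simp [contract]
    | add s s' hs hs' =>
      convert add _ _ hs hs' using 1
      simp only [contract, map_add, mul_add, add_mul, mul_sub, sub_mul]
      abel
    | tmul b v' =>
      induction t using TensorProduct.induction_on with
      | zero =>
        convert zero
        simp [contract]
      | add t t' ht ht' =>
        convert add _ _ ht ht' using 1
        simp only [contract, map_add, mul_add, add_mul, mul_sub, sub_mul]
        abel
      | tmul c w' =>
        rw [contract_smul_constCl, bivector_contract hsymm]
        exact scalar _ _

theorem contract_mul_comm (hsymm : η.IsSymm) (hJ : ∀ v, J (J v) = -v)
    {u : Val A η} (hu : u ∈ valType A η J 1 1) (s t : A ⊗[ℝ] V) (x : Val A η) :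
    contract u s t * x = x * contract u s t := by
  refine contract_induction hsymm hJ (motive := fun y => y * x = x * y) hu s t ?_ ?_
  · intro a c
    exact smul_constCl_algebraMap_mul_comm a c x
  · intro y z hy hz
    rw [add_mul, mul_add, hy, hz]

/-- The automorphism induced by `J` fixes `u` and fixes the contraction, which is a scalar function;
on the two vectors it acts as `J`. -/
theorem contract_baseChange (hsymm : η.IsSymm) (hJ : ∀ v, J (J v) = -v)
    (hηJ : ∀ v w, η (J v) (J w) = η v w) {u : Val A η} (hu : u ∈ valType A η J 1 1)
    (s t : A ⊗[ℝ] V) : contract u (J.baseChange A s) (J.baseChange A t) = contract u s t := by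
  have h : mapJVal A hηJ (contract u s t) = contract u s t := by
    refine contract_induction hsymm hJ (motive := fun y => mapJVal A hηJ y = y) hu s t ?_ ?_
    · intro a c
      rw [mapJVal_smul_constCl, AlgHom.commutes]
    · intro y z hy hz
      rw [map_add, hy, hz]
  rw [← h]
  simp only [contract, map_add, map_sub, map_mul, mapJVal_vecVal, mapJVal_of_mem_valType hJ hηJ hu]

variable [FiniteDimensional ℝ V]

/-- The vector `b_a` of the fixed basis of `V`, as a constant function. -/
abbrev basisFun (A : Type*) [CommRing A] [Algebra ℝ A] (a : Fin (Module.finrank ℝ V)) :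
    A ⊗[ℝ] V := 1 ⊗ₜ[ℝ] Module.finBasis ℝ V a

/-- A function of degree `(1, 1)` is determined by its contractions with the basis vectors. -/
theorem sum_contract_mul (hsymm : η.IsSymm) (hη : η.Nondegenerate) (hJ : ∀ v, J (J v) = -v)
    {u : Val A η} (hu : u ∈ valType A η J 1 1) :
    ∑ a, ∑ c, contract u (basisFun A a) (basisFun A c) *
      (constVal A η (1 ⊗ₜ[ℝ] dualVec hη a) * constVal A η (1 ⊗ₜ[ℝ] dualVec hη c)) =
      (-8 : ℂ) • u := by
  induction hu using valType_one_one_induction hJ with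
  | add u v _ _ hu hv =>
    simp only [contract_add, add_mul, Finset.sum_add_distrib, hu, hv, smul_add]
  | bivector r v w =>
    generalize holPart J v = x
    generalize antiholPart J w = y
    -- The dual basis expansion turns the double sum into `y x - x y`, which is `-2` times the
    -- bivector. With the factor `4` of `bivector_contract` this gives `-8`.
    have key : ∑ a, ∑ c, (complexForm η y (1 ⊗ₜ[ℝ] Module.finBasis ℝ V a) *
          complexForm η x (1 ⊗ₜ[ℝ] Module.finBasis ℝ V c) -
        complexForm η x (1 ⊗ₜ[ℝ] Module.finBasis ℝ V a) *
          complexForm η y (1 ⊗ₜ[ℝ] Module.finBasis ℝ V c)) •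
        (CliffordAlgebra.ι (quad η) (1 ⊗ₜ[ℝ] dualVec hη a) *
          CliffordAlgebra.ι (quad η) (1 ⊗ₜ[ℝ] dualVec hη c)) = (-2 : ℂ) • bivector η x y := by
      simp only [sub_smul, Finset.sum_sub_distrib, ← smul_mul_smul_comm, ← Finset.mul_sum,
        ← Finset.sum_mul, sum_complexForm_smul hη]
      rw [bivector]
      module
    have h : ∀ a c, contract (r • constCl A η (bivector η x y)) (basisFun A a) (basisFun A c) *
        (constVal A η (1 ⊗ₜ[ℝ] dualVec hη a) * constVal A η (1 ⊗ₜ[ℝ] dualVec hη c)) =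
        r • constCl A η ((4 : ℂ) • ((complexForm η y (1 ⊗ₜ[ℝ] Module.finBasis ℝ V a) *
          complexForm η x (1 ⊗ₜ[ℝ] Module.finBasis ℝ V c) -
        complexForm η x (1 ⊗ₜ[ℝ] Module.finBasis ℝ V a) *
          complexForm η y (1 ⊗ₜ[ℝ] Module.finBasis ℝ V c)) •
        (CliffordAlgebra.ι (quad η) (1 ⊗ₜ[ℝ] dualVec hη a) *
          CliffordAlgebra.ι (quad η) (1 ⊗ₜ[ℝ] dualVec hη c)))) := by
      intro a c
      rw [contract_smul_constCl, bivector_contract hsymm, mul_one, mul_one, ← constCl_ι,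
        ← constCl_ι, ← map_mul, smul_mul_assoc, ← map_mul, smul_smul, ← Algebra.smul_def]
    simp only [h, ← Finset.smul_sum, ← map_sum, key]
    rw [smul_smul, map_smul, smul_smul_comm_val]
    norm_num

theorem eq_zero_of_contract_eq_zero (hsymm : η.IsSymm) (hη : η.Nondegenerate)
    (hJ : ∀ v, J (J v) = -v) {u : Val A η} (hu : u ∈ valType A η J 1 1)
    (h : ∀ s t, contract u s t = 0) : u = 0 := by
  have e := sum_contract_mul hsymm hη hJ hu
  simp only [h, zero_mul, Finset.sum_const_zero] at e
  exact (smul_eq_zero.1 e.symm).resolve_left (by norm_num)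

end Contract

/-! ## Sums over cyclic permutations -/

section Cyclic

/-- The classical argument for the pair symmetry of the Riemann tensor: four cyclic identities,
taken with signs `+ + - -`, leave twice the difference of the two sides. -/
theorem eq_of_cyclic_of_antisymm {X M : Type*} [AddCommGroup M] [Module ℂ M]
    (S : X → X → X → X → M) (h₁ : ∀ x y z t, S y x z t = -S x y z t)
    (h₂ : ∀ x y z t, S x y t z = -S x y z t)
    (h₃ : ∀ x y z t, S x y z t + S y z x t + S z x y t = 0) (x y z t : X) :
    S x y z t = S z t x y := by
  have b1 := h₃ x y z t
  have b2 := h₃ y z t x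
  have b3 := h₃ z t x y
  have b4 := h₃ t x y z
  rw [h₂ y z x t, h₂ z t x y, h₁ y t z x, h₂ y t x z, neg_neg] at b2
  rw [h₁ x t z y, h₂ x t y z, neg_neg, h₁ z x t y, h₂ z x y t, neg_neg] at b3
  rw [h₁ x t y z, h₂ x y z t] at b4
  have h₄ : (2 : ℂ) • (S x y z t - S z t x y) = 0 := by
    linear_combination (norm := module) b1 + b2 - b3 - b4
  exact sub_eq_zero.1 ((smul_eq_zero.1 h₄).resolve_left two_ne_zero)

/-- Antisymmetry of `S` in its last two indices replaces `b_j b_k` by its commutator. As the `{b_i,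
b_j}` are central, `{b_i, [b_j, b_k]}` is invariant under cyclic permutations, so the cyclic sum of
`S` factors out. The factor `6` counts the permutations. -/
theorem sum_cyclic_eq_zero {ι B : Type*} [Fintype ι] [Ring B] [Algebra ℂ B]
    (S : ι → ι → ι → B) (b : ι → B)
    (hb : ∀ i j x, (b i * b j + b j * b i) * x = x * (b i * b j + b j * b i))
    (h₂ : ∀ i j k, S i k j = -S i j k) (h₃ : ∀ i j k, S i j k + S j k i + S k i j = 0) :
    ∑ i, ∑ j, ∑ k, S i j k * (b i * (b j * b k) + (b j * b k) * b i) = 0 := by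
  have rot : ∀ f : ι → ι → ι → B, ∑ i, ∑ j, ∑ k, f j k i = ∑ i, ∑ j, ∑ k, f i j k := by
    intro f
    rw [Finset.sum_comm]
    exact Finset.sum_congr rfl fun i _ => Finset.sum_comm
  have swap : ∀ f : ι → ι → ι → B, ∑ i, ∑ j, ∑ k, f i k j = ∑ i, ∑ j, ∑ k, f i j k :=
    fun f => Finset.sum_congr rfl fun i _ => Finset.sum_comm
  set f : ι → ι → ι → B := fun i j k => S i j k * (b i * (b j * b k) + (b j * b k) * b i) with hf
  let g : ι → ι → ι → B := fun i j k => b i * (b j * b k) + (b j * b k) * b i -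
    (b i * (b k * b j) + (b k * b j) * b i)
  have hg : ∀ i j k, g j k i = g i j k := by
    intro i j k
    rw [← sub_eq_zero, ← sub_eq_zero.2 (hb i j (b k)).symm]
    simp only [g]
    noncomm_ring
  have key : ∀ i j k, f i j k + f j k i + f k i j + (f i k j + f j i k + f k j i) = 0 := by
    intro i j k
    have e : f i j k + f j k i + f k i j + (f i k j + f j i k + f k j i) =
        S i j k * g i j k + S j k i * g j k i + S k i j * g k i j := by
      simp only [hf, g, h₂ i j k, h₂ j k i, h₂ k i j]
      noncomm_ring
    rw [e, hg i j k, ← hg k i j, ← add_mul, ← add_mul, h₃, zero_mul]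
  have h : (6 : ℂ) • ∑ i, ∑ j, ∑ k, f i j k =
      ∑ i, ∑ j, ∑ k, (f i j k + f j k i + f k i j + (f i k j + f j i k + f k j i)) := by
    simp only [Finset.sum_add_distrib]
    rw [rot fun i j k => f i j k, rot fun i j k => f j k i, swap fun i j k => f i j k,
      swap fun i j k => f j k i, swap fun i j k => f k i j, rot fun i j k => f i j k,
      rot fun i j k => f j k i, rot fun i j k => f i j k]
    module
  simp only [key, Finset.sum_const_zero] at h
  exact (smul_eq_zero.1 h).resolve_left (by norm_num)

end Cyclic

/-! ## Curvature and torsion -/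

section Curvature

variable {V : Type*} [AddCommGroup V] [Module ℝ V]
variable {A : Type*} [CommRing A] [Algebra ℝ A]
variable {η : LinearMap.BilinForm ℝ V} {J : V →ₗ[ℝ] V}

theorem oneForm_apply (α : OneForm A η) (v : Fin 1 → Vec A) : oneForm α v = α (v 0) := rfl

theorem d_apply (α : OneForm A η) (v : Fin 2 → Vec A) :
    d α v = lieVal (v 0) (α (v 1)) - lieVal (v 1) (α (v 0)) - α ⁅v 0, v 1⁆ := rfl

theorem leftProd_apply {k : ℕ} (α : OneForm A η) (x : Form A η k) (v : Fin (k + 1) → Vec A) :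
    leftProd α x v = ∑ i : Fin (k + 1), (-1) ^ (i : ℕ) • (α (v i) * x (i.removeNth v)) := by
  rw [leftProd, AlternatingMap.alternatizeUncurryFin_apply]
  rfl

theorem rightProd_apply {k : ℕ} (x : Form A η k) (α : OneForm A η) (v : Fin (k + 1) → Vec A) :
    rightProd x α v =
      (-1 : ℤ) ^ k • ∑ i : Fin (k + 1), (-1) ^ (i : ℕ) • (x (i.removeNth v) * α (v i)) := by
  rw [rightProd, AlternatingMap.smul_apply, AlternatingMap.alternatizeUncurryFin_apply]
  rfl

theorem prod_apply (α β : OneForm A η) (v : Fin 2 → Vec A) :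
    prod α β v = α (v 0) * β (v 1) - α (v 1) * β (v 0) := by
  rw [prod, leftProd_apply, Fin.sum_univ_two, oneForm_apply, oneForm_apply]
  simp [Fin.removeNth, sub_eq_add_neg]

theorem curvature_apply (ω : OneForm A η) (v : Fin 2 → Vec A) :
    curvature ω v = lieVal (v 0) (ω (v 1)) - lieVal (v 1) (ω (v 0)) - ω ⁅v 0, v 1⁆ +
      (ω (v 0) * ω (v 1) - ω (v 1) * ω (v 0)) := by
  rw [curvature, AlternatingMap.add_apply, d_apply, prod_apply]

theorem form_two_swap (x : Form A η 2) (X Y : Vec A) : x ![Y, X] = -x ![X, Y] := by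
  have h := x.map_swap ![X, Y] (i := 0) (j := 1) (by decide)
  rw [← h]
  congr 1
  ext i
  fin_cases i <;> rfl

theorem form_two_eta (x : Form A η 2) (v : Fin 2 → Vec A) : x v = x ![v 0, v 1] := by
  congr 1
  ext i
  fin_cases i <;> rfl

/-- The first Bianchi identity for a torsion-free connection. -/
theorem bianchi {ω τ : OneForm A η} (h : torsion τ ω = 0) (X Y Z : Vec A) :
    (curvature ω ![X, Y] * τ Z - τ Z * curvature ω ![X, Y]) +
      (curvature ω ![Y, Z] * τ X - τ X * curvature ω ![Y, Z]) +
      (curvature ω ![Z, X] * τ Y - τ Y * curvature ω ![Z, X]) = 0 := by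
  have ht : ∀ X Y : Vec A, lieVal X (τ Y) - lieVal Y (τ X) - τ ⁅X, Y⁆ +
      (ω X * τ Y - ω Y * τ X) + (τ X * ω Y - τ Y * ω X) = 0 := by
    intro X Y
    have := congrArg (fun x : Form A η 2 => x ![X, Y]) h
    simpa [torsion, d_apply, prod_apply] using this
  have hl : ∀ X Y Z : Vec A, lieVal X (lieVal Y (τ Z)) - lieVal X (lieVal Z (τ Y)) -
      lieVal X (τ ⁅Y, Z⁆) +
      (lieVal X (ω Y) * τ Z + ω Y * lieVal X (τ Z) -
        (lieVal X (ω Z) * τ Y + ω Z * lieVal X (τ Y))) +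
      (lieVal X (τ Y) * ω Z + τ Y * lieVal X (ω Z) -
        (lieVal X (τ Z) * ω Y + τ Z * lieVal X (ω Y))) = 0 := by
    intro X Y Z
    have := congrArg (lieVal X) (ht Y Z)
    simpa only [map_add, map_sub, lieVal_mul, map_zero] using this
  have jac : τ ⁅X, ⁅Y, Z⁆⁆ + τ ⁅Y, ⁅Z, X⁆⁆ + τ ⁅Z, ⁅X, Y⁆⁆ = 0 := by
    rw [← map_add, ← map_add, lie_jacobi, map_zero]
  have c : ∀ (W : Vec A) {u : Val A η}, u = 0 → ω W * u - u * ω W = 0 := by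
    rintro W _ rfl
    simp
  have cX := c X (ht Y Z)
  have cY := c Y (ht Z X)
  have cZ := c Z (ht X Y)
  simp only [curvature_apply, Matrix.cons_val_zero, Matrix.cons_val_one]
  -- The derivatives of the torsion and its commutators with `ω` form its covariant exterior
  -- derivative. The torsion at a field and a bracket removes the terms in `τ ⁅Y, Z⁆`, and the
  -- triple brackets cancel by the Jacobi identity.
  linear_combination (norm := skip) hl X Y Z + hl Y Z X + hl Z X Y + cX + cY + cZ +
    ht X ⁅Y, Z⁆ + ht Y ⁅Z, X⁆ + ht Z ⁅X, Y⁆ + jac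
  simp only [lieVal_lie, mul_add, mul_sub, add_mul, sub_mul, mul_assoc]
  abel

end Curvature

/-! ## The type decomposition -/

section Types

variable {V : Type*} [AddCommGroup V] [Module ℝ V]
variable {A : Type*} [CommRing A] [Algebra ℝ A]
variable {η : LinearMap.BilinForm ℝ V} {J : V →ₗ[ℝ] V} {θ : Vielbein A V}

theorem real_smul_val (r : ℝ) (u : Val A η) : r • u = (r : ℂ) • u := by
  rw [Algebra.smul_def, Algebra.smul_def]
  rfl

theorem real_smul_vec (r : ℝ) (X : Vec A) : r • X = algebraMap ℝ A r • X :=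
  (algebraMap_smul A r X).symm

theorem algebraMap_smul_val (r : ℝ) (u : Val A η) : algebraMap ℝ A r • u = (r : ℂ) • u :=
  (algebraMap_smul A r u).trans (real_smul_val r u)

theorem form_two_smul_add_left (x : Form A η 2) (a b : A) (X X' Y : Vec A) :
    x ![a • X + b • X', Y] = a • x ![X, Y] + b • x ![X', Y] := by
  rw [AlternatingMap.map_vecCons_add, AlternatingMap.map_vecCons_smul,
    AlternatingMap.map_vecCons_smul]

theorem form_two_smul_add_right (x : Form A η 2) (a b : A) (X Y Y' : Vec A) :
    x ![X, a • Y + b • Y'] = a • x ![X, Y] + b • x ![X, Y'] := by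
  rw [form_two_swap, form_two_smul_add_left, form_two_swap x X Y, form_two_swap x X Y']
  module

theorem theta_almostComplex (X : Vec A) : θ (almostComplex θ J X) = J.baseChange A (θ X) :=
  θ.apply_symm_apply _

theorem almostComplex_almostComplex (hJ : ∀ v, J (J v) = -v) (X : Vec A) :
    almostComplex θ J (almostComplex θ J X) = -X := by
  apply θ.injective
  rw [theta_almostComplex, theta_almostComplex, ← LinearMap.comp_apply, ← LinearMap.baseChange_comp,
    map_neg]
  have h : J ∘ₗ J = -LinearMap.id := LinearMap.ext hJ
  rw [h, LinearMap.baseChange_neg, LinearMap.baseChange_id]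
  rfl

theorem almostComplex_eq (X : Vec A) :
    (Complex.I.re • X + Complex.I.im • almostComplex θ J X) = almostComplex θ J X := by
  simp

/-- The two projections add up to the identity, so `θ + θ̄` is the vielbein itself, embedded in the
Clifford algebra. -/
theorem theta_add_thetaBar_apply (X : Vec A) :
    (theta η θ J + thetaBar η θ J) X = vecVal A η (θ X) := by
  have h : (constVal A η ∘ₗ holPart J).liftBaseChange A +
      (constVal A η ∘ₗ antiholPart J).liftBaseChange A = vecVal A η := by
    ext v
    simp only [LinearMap.add_apply, LinearMap.liftBaseChange_tmul, vecVal,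
      TensorProduct.AlgebraTensorModule.curry_apply, TensorProduct.curry_apply, one_smul,
      LinearMap.coe_restrictScalars, LinearMap.comp_apply, ← map_add, holPart_add_antiholPart]
    rfl
  rw [← h]
  rfl

theorem mapJVal_theta (hJ : ∀ v, J (J v) = -v) (hηJ : ∀ v w, η (J v) (J w) = η v w) (X : Vec A) :
    mapJVal A hηJ (theta η θ J X) = Complex.I • theta η θ J X := by
  change mapJVal A hηJ ((constVal A η ∘ₗ holPart J).liftBaseChange A (θ X)) =
    Complex.I • (constVal A η ∘ₗ holPart J).liftBaseChange A (θ X)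
  induction θ X using TensorProduct.induction_on with
  | zero => simp
  | add s t hs ht => simp only [map_add, hs, ht, smul_add]
  | tmul a v =>
    rw [LinearMap.liftBaseChange_tmul, mapJVal_smul, LinearMap.comp_apply, mapJVal_constVal,
      baseChange_holPart hJ, constVal_smul, smul_smul_comm_val]

theorem mapJVal_thetaBar (hJ : ∀ v, J (J v) = -v) (hηJ : ∀ v w, η (J v) (J w) = η v w)
    (X : Vec A) : mapJVal A hηJ (thetaBar η θ J X) = -(Complex.I • thetaBar η θ J X) := by
  change mapJVal A hηJ ((constVal A η ∘ₗ antiholPart J).liftBaseChange A (θ X)) =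
    -(Complex.I • (constVal A η ∘ₗ antiholPart J).liftBaseChange A (θ X))
  induction θ X using TensorProduct.induction_on with
  | zero => simp
  | add s t hs ht => simp only [map_add, hs, ht, smul_add, neg_add]
  | tmul a v =>
    rw [LinearMap.liftBaseChange_tmul, mapJVal_smul, LinearMap.comp_apply, mapJVal_constVal,
      baseChange_antiholPart hJ, map_neg, constVal_smul, smul_smul_comm_val, smul_neg]

theorem ofForm_self {k : ℕ} (x : Form A η k) : ofForm k x k = x := Pi.single_eq_same k x

theorem ofForm_of_ne {k l : ℕ} (h : l ≠ k) (x : Form A η k) : ofForm k x l = 0 :=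
  Pi.single_eq_of_ne h x

theorem mem_valType_of_mem_OmegaType_one_zero {ω : OneForm A η}
    (hω : ofForm 1 (oneForm ω) ∈ OmegaType θ η J 1 1 1 0) (X : Vec A) :
    ω X ∈ valType A η J 1 1 := by
  have h := hω.2.1 (fun _ => X)
  change ofForm 1 (oneForm ω) 1 _ ∈ _ at h
  rwa [ofForm_self] at h

theorem mem_valType_of_mem_OmegaType_zero_one {ω : OneForm A η}
    (hω : ofForm 1 (oneForm ω) ∈ OmegaType θ η J 1 1 0 1) (X : Vec A) :
    ω X ∈ valType A η J 1 1 := by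
  have h := hω.2.1 (fun _ => X)
  change ofForm 1 (oneForm ω) 1 _ ∈ _ at h
  rwa [ofForm_self] at h

theorem apply_almostComplex_of_mem_OmegaType_one_zero {ω : OneForm A η}
    (hω : ofForm 1 (oneForm ω) ∈ OmegaType θ η J 1 1 1 0) (X : Vec A) :
    ω (almostComplex θ J X) = Complex.I • ω X := by
  have h := hω.2.2 Complex.I (fun _ => X)
  change ofForm 1 (oneForm ω) 1 (fun _ : Fin 1 => _) = _ • ofForm 1 (oneForm ω) 1 (fun _ => X) at h
  rw [ofForm_self, oneForm_apply, oneForm_apply, almostComplex_eq] at h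
  simpa using h

theorem apply_almostComplex_of_mem_OmegaType_zero_one {ω : OneForm A η}
    (hω : ofForm 1 (oneForm ω) ∈ OmegaType θ η J 1 1 0 1) (X : Vec A) :
    ω (almostComplex θ J X) = -(Complex.I • ω X) := by
  have h := hω.2.2 Complex.I (fun _ => X)
  change ofForm 1 (oneForm ω) 1 (fun _ : Fin 1 => _) = _ • ofForm 1 (oneForm ω) 1 (fun _ => X) at h
  rw [ofForm_self, oneForm_apply, oneForm_apply, almostComplex_eq] at h
  simpa using h

/-- A 2-form with values of degree `(1, 1)` that is invariant under the almost complex structure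
is of type `(1, 1)`. -/
theorem ofForm_mem_OmegaType_one_one (hJ : ∀ v, J (J v) = -v) {x : Form A η 2}
    (hx : ∀ X Y, x ![X, Y] ∈ valType A η J 1 1)
    (hxJ : ∀ X Y, x ![almostComplex θ J X, almostComplex θ J Y] = x ![X, Y]) :
    ofForm 2 x ∈ OmegaType θ η J 1 1 1 1 := by
  refine ⟨fun k hk => ofForm_of_ne hk x, fun v => ?_, fun z v => ?_⟩
  · change ofForm 2 x 2 v ∈ _
    rw [ofForm_self, form_two_eta]
    exact hx _ _
  · change ofForm 2 x 2 _ = _ • ofForm 2 x 2 v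
    rw [ofForm_self, form_two_eta, form_two_eta x v]
    -- Invariance and `J² = -1` move `J` to the other argument at the cost of a sign. The cross
    -- terms therefore cancel, and the factor `|z|²` remains.
    have h : x ![almostComplex θ J (v 0), v 1] = -x ![v 0, almostComplex θ J (v 1)] := by
      rw [← hxJ (v 0), almostComplex_almostComplex hJ]
      have := form_two_smul_add_right x (-1) 0 (almostComplex θ J (v 0)) (v 1) 0
      simp only [neg_smul, one_smul, zero_smul, add_zero] at this
      rw [this, neg_neg]
    simp only [real_smul_vec, form_two_smul_add_left, form_two_smul_add_right, hxJ, h,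
      algebraMap_smul_val]
    have hz : z ^ 1 * (starRingEnd ℂ z) ^ 1 = (z.re : ℂ) * z.re + z.im * z.im := by
      rw [pow_one, pow_one, Complex.mul_conj, Complex.normSq_apply]
      push_cast
      rfl
    rw [hz]
    module

/-! ### Symmetries of the curvature of a torsion-free connection -/

variable {ω : OneForm A η}

theorem curvature_mem_valType (hsymm : η.IsSymm) (hJ : ∀ v, J (J v) = -v)
    (hηJ : ∀ v w, η (J v) (J w) = η v w) (hω : ∀ X, ω X ∈ valType A η J 1 1)
    (v : Fin 2 → Vec A) : curvature ω v ∈ valType A η J 1 1 := by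
  rw [curvature_apply]
  exact add_mem (sub_mem (sub_mem (lieVal_mem_valType hJ _ (hω _)) (lieVal_mem_valType hJ _ (hω _)))
    (hω _)) (mul_sub_mul_mem_valType hsymm hJ hηJ (hω _) (hω _))

theorem bianchi_vecVal (htorsion : torsion (theta η θ J + thetaBar η θ J) ω = 0) (X Y Z : Vec A) :
    (curvature ω ![X, Y] * vecVal A η (θ Z) - vecVal A η (θ Z) * curvature ω ![X, Y]) +
      (curvature ω ![Y, Z] * vecVal A η (θ X) - vecVal A η (θ X) * curvature ω ![Y, Z]) +
      (curvature ω ![Z, X] * vecVal A η (θ Y) - vecVal A η (θ Y) * curvature ω ![Z, X]) = 0 := by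
  have h := bianchi htorsion X Y Z
  simpa only [theta_add_thetaBar_apply] using h

theorem contract_curvature_cyclic (htorsion : torsion (theta η θ J + thetaBar η θ J) ω = 0)
    (X Y Z : Vec A) (t : A ⊗[ℝ] V) :
    contract (curvature ω ![X, Y]) (θ Z) t + contract (curvature ω ![Y, Z]) (θ X) t +
      contract (curvature ω ![Z, X]) (θ Y) t = 0 := by
  have h := bianchi_vecVal htorsion X Y Z
  simp only [contract]
  generalize curvature ω ![X, Y] * vecVal A η (θ Z) - vecVal A η (θ Z) * curvature ω ![X, Y] = a at *
  generalize curvature ω ![Y, Z] * vecVal A η (θ X) - vecVal A η (θ X) * curvature ω ![Y, Z] = b at *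
  generalize curvature ω ![Z, X] * vecVal A η (θ Y) - vecVal A η (θ Y) * curvature ω ![Z, X] = c at *
  have e : a * vecVal A η t + vecVal A η t * a + (b * vecVal A η t + vecVal A η t * b) +
      (c * vecVal A η t + vecVal A η t * c) =
      (a + b + c) * vecVal A η t + vecVal A η t * (a + b + c) := by
    noncomm_ring
  rw [e, h, zero_mul, mul_zero, add_zero]

/-- The pair symmetry of the curvature of a torsion-free connection. -/
theorem contract_curvature_pair (hsymm : η.IsSymm)
    (htorsion : torsion (theta η θ J + thetaBar η θ J) ω = 0) (X Y Z W : Vec A) :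
    contract (curvature ω ![X, Y]) (θ Z) (θ W) = contract (curvature ω ![Z, W]) (θ X) (θ Y) := by
  refine eq_of_cyclic_of_antisymm
    (fun X Y Z W => contract (curvature ω ![X, Y]) (θ Z) (θ W)) ?_ ?_ ?_ X Y Z W
  · intro X Y Z W
    change contract _ _ _ = -contract _ _ _
    rw [form_two_swap, contract_neg]
  · intro X Y Z W
    exact contract_swap hsymm _ _ _
  · intro X Y Z W
    exact contract_curvature_cyclic htorsion X Y Z (θ W)

/-- Pair symmetry carries `J` from the form arguments to the vectors contracted with the value,
where it has no effect, and then carries the pairs back. Contractions determine a value of degree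
`(1,1)`. -/
theorem curvature_almostComplex [FiniteDimensional ℝ V] (hsymm : η.IsSymm) (hη : η.Nondegenerate)
    (hJ : ∀ v, J (J v) = -v) (hηJ : ∀ v w, η (J v) (J w) = η v w)
    (hω : ∀ X, ω X ∈ valType A η J 1 1)
    (htorsion : torsion (theta η θ J + thetaBar η θ J) ω = 0) (X Y : Vec A) :
    curvature ω ![almostComplex θ J X, almostComplex θ J Y] = curvature ω ![X, Y] := by
  have hR := curvature_mem_valType hsymm hJ hηJ hω
  rw [← sub_eq_zero]
  refine eq_zero_of_contract_eq_zero hsymm hη hJ (sub_mem (hR _) (hR _)) fun s t => ?_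
  -- Pair symmetry speaks of vector fields; nondegeneracy of the vielbein supplies them.
  obtain ⟨Z, rfl⟩ := θ.surjective s
  obtain ⟨W, rfl⟩ := θ.surjective t
  rw [contract_sub, contract_curvature_pair hsymm htorsion, theta_almostComplex,
    theta_almostComplex, contract_baseChange hsymm hJ hηJ (hR _),
    contract_curvature_pair hsymm htorsion, sub_self]

/-! ### The formula for the curvature -/

theorem part10_of_type_one_zero (h : ∀ X, ω (almostComplex θ J X) = Complex.I • ω X) :
    part10 θ J ω = ω := by
  ext1 X
  change (2⁻¹ : ℂ) • (ω X - Complex.I • ω (almostComplex θ J X)) = ω X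
  rw [h, smul_smul, Complex.I_mul_I]
  module

theorem part01_of_type_one_zero (h : ∀ X, ω (almostComplex θ J X) = Complex.I • ω X) :
    part01 θ J ω = 0 := by
  ext1 X
  change (2⁻¹ : ℂ) • (ω X + Complex.I • ω (almostComplex θ J X)) = 0
  rw [h, smul_smul, Complex.I_mul_I]
  module

theorem part10_of_type_zero_one (h : ∀ X, ω (almostComplex θ J X) = -(Complex.I • ω X)) :
    part10 θ J ω = 0 := by
  ext1 X
  change (2⁻¹ : ℂ) • (ω X - Complex.I • ω (almostComplex θ J X)) = 0
  rw [h, smul_neg, smul_smul, Complex.I_mul_I]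
  module

theorem part01_of_type_zero_one (h : ∀ X, ω (almostComplex θ J X) = -(Complex.I • ω X)) :
    part01 θ J ω = ω := by
  ext1 X
  change (2⁻¹ : ℂ) • (ω X + Complex.I • ω (almostComplex θ J X)) = ω X
  rw [h, smul_neg, smul_smul, Complex.I_mul_I]
  module

theorem d_zero : d (0 : OneForm A η) = 0 := by
  ext v
  simp [d_apply]

theorem d_add (α β : OneForm A η) : d (α + β) = d α + d β := by
  ext v
  simp only [d_apply, AlternatingMap.add_apply, LinearMap.add_apply, map_add]
  abel

theorem part11_apply (β : Form A η 2) (v : Fin 2 → Vec A) :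
    part11 θ J β v = (2⁻¹ : ℂ) • (β v + β ![almostComplex θ J (v 0), almostComplex θ J (v 1)]) := by
  rw [part11, AlternatingMap.smul_apply, AlternatingMap.add_apply,
    AlternatingMap.compLinearMap_apply,
    form_two_eta β fun i => almostComplex θ J (v i)]

theorem part20_zero : part20 θ J (0 : Form A η 2) = 0 := by
  simp [part20, mixed]

theorem part02_zero : part02 θ J (0 : Form A η 2) = 0 := by
  simp [part02, mixed]

/-- The curvature of a connection with parts `ω` of type `(1,0)` and `ω'` of type `(0,1)`, if it is
invariant under the almost complex structure. -/
theorem curvature_eq {ω' : OneForm A η}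
    (h : ∀ X, ω (almostComplex θ J X) = Complex.I • ω X)
    (h' : ∀ X, ω' (almostComplex θ J X) = -(Complex.I • ω' X))
    (hR : ∀ X Y, curvature (ω + ω') ![almostComplex θ J X, almostComplex θ J Y] =
      curvature (ω + ω') ![X, Y]) :
    curvature (ω + ω') = del θ J ω' + delBar θ J ω + prod ω ω' + prod ω' ω := by
  -- Once projected, `ω ω` and `ω' ω'` cancel, since `J` on both arguments multiplies them by `-1`.
  -- The mixed products are invariant, and `∂ω'` and `∂̄ω` are the `(1,1)`-parts of `dω'` and `dω`.
  have e : curvature (ω + ω') = part11 θ J (curvature (ω + ω')) := by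
    ext v
    rw [part11_apply, hR, ← form_two_eta]
    module
  rw [e, del, delBar, part10_of_type_zero_one h', part01_of_type_zero_one h',
    part10_of_type_one_zero h, part01_of_type_one_zero h, d_zero, part20_zero, part02_zero]
  ext v
  simp only [curvature, d_add, part11_apply, AlternatingMap.add_apply, prod_apply,
    LinearMap.add_apply, Matrix.cons_val_zero, Matrix.cons_val_one, h, h', AlternatingMap.zero_apply,
    add_mul, mul_add, smul_mul_assoc, mul_smul_comm, neg_mul, mul_neg, smul_add, smul_neg,
    smul_smul, Complex.I_mul_I]
  module

end Types

/-! ## The operators that annihilate the curvature -/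

section Operators

variable {V : Type*} [AddCommGroup V] [Module ℝ V]
variable {A : Type*} [CommRing A] [Algebra ℝ A]
variable {η : LinearMap.BilinForm ℝ V} {J : V →ₗ[ℝ] V} {θ : Vielbein A V}

theorem parity_ofForm_two {x : Form A η 2} (hx : ∀ v, involuteVal (x v) = x v) :
    parity (ofForm 2 x) = ofForm 2 x := by
  funext k
  change (-1 : ℂ) ^ k • involuteVal.compAlternatingMap (ofForm 2 x k) = ofForm 2 x k
  by_cases hk : k = 2
  · subst hk
    rw [ofForm_self]
    ext v
    rw [AlternatingMap.smul_apply, LinearMap.compAlternatingMap_apply, hx]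
    norm_num
  · rw [ofForm_of_ne hk]
    ext v
    simp

/-- A 2-form with even values has even total degree, so the operator is half the commutator with
`α`. -/
theorem superMinus_ofForm_two {x : Form A η 2} (hx : ∀ v, involuteVal (x v) = x v)
    {α : OneForm A η} (h : leftProd α x = rightProd x α) : superMinus α (ofForm 2 x) = 0 := by
  rw [superMinus, LinearMap.smul_apply, LinearMap.sub_apply, Module.End.mul_apply,
    parity_ofForm_two hx]
  suffices e : leftMul α (ofForm 2 x) = rightMul α (ofForm 2 x) by rw [e, sub_self, smul_zero]
  funext k
  match k with
  | 0 => rfl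
  | k + 1 =>
    change leftProd α (ofForm 2 x k) = rightProd (ofForm 2 x k) α
    by_cases hk : k = 2
    · subst hk
      rw [ofForm_self, h]
    · rw [ofForm_of_ne hk]
      ext v
      simp [leftProd_apply, rightProd_apply]

/-- On three arguments, the signed sum over the omitted one is a cyclic sum: the sign of the middle
term reverses the remaining pair. -/
theorem leftProd_eq_rightProd {x : Form A η 2} {α : OneForm A η}
    (h : ∀ X Y Z, (x ![X, Y] * α Z - α Z * x ![X, Y]) + (x ![Y, Z] * α X - α X * x ![Y, Z]) +
      (x ![Z, X] * α Y - α Y * x ![Z, X]) = 0) : leftProd α x = rightProd x α := by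
  ext v
  have e0 : x (Fin.removeNth 0 v) = x ![v 1, v 2] := form_two_eta _ _
  have e1 : x (Fin.removeNth 1 v) = -x ![v 2, v 0] := by
    rw [form_two_eta, ← form_two_swap]
    rfl
  have e2 : x (Fin.removeNth 2 v) = x ![v 0, v 1] := form_two_eta _ _
  rw [leftProd_apply, rightProd_apply, Fin.sum_univ_three, Fin.sum_univ_three, e0, e1, e2,
    ← sub_eq_zero, ← neg_eq_zero, ← h (v 0) (v 1) (v 2)]
  simp
  abel

theorem cliffordWedge_apply (w : ℂ ⊗[ℝ] V) (x : Omega A η) (k : ℕ) (v : Fin k → Vec A) :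
    cliffordWedge w x k v =
      (2⁻¹ : ℂ) • (constVal A η w * x k v + involuteVal (x k v) * constVal A η w) := rfl

theorem cliffordInterior_apply (w : ℂ ⊗[ℝ] V) (x : Omega A η) (k : ℕ) (v : Fin k → Vec A) :
    cliffordInterior w x k v =
      (2⁻¹ : ℂ) • (constVal A η w * x k v - involuteVal (x k v) * constVal A η w) := rfl

theorem interior_apply (X : Vec A) (x : Omega A η) (k : ℕ) (v : Fin k → Vec A) :
    interior X x k v = x (k + 1) (Matrix.vecCons X v) := rfl

theorem constVal_antiholPart (v : V) : constVal A η (antiholPart J v) =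
    (2⁻¹ : ℂ) • (constVal A η (1 ⊗ₜ[ℝ] v) + Complex.I • constVal A η (1 ⊗ₜ[ℝ] J v)) := by
  rw [← constVal_smul, ← map_add, ← constVal_smul, antiholPart_apply, TensorProduct.smul_tmul',
    smul_add, TensorProduct.smul_tmul', TensorProduct.smul_tmul']
  simp [div_eq_inv_mul]

theorem constVal_holPart (v : V) : constVal A η (holPart J v) =
    (2⁻¹ : ℂ) • (constVal A η (1 ⊗ₜ[ℝ] v) - Complex.I • constVal A η (1 ⊗ₜ[ℝ] J v)) := by
  rw [← constVal_smul, ← map_sub, ← constVal_smul, holPart_apply, TensorProduct.smul_tmul',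
    smul_sub, TensorProduct.smul_tmul', TensorProduct.smul_tmul']
  simp [div_eq_inv_mul]

/-! ### The Bianchi identity in types -/

variable {ω : OneForm A η}

theorem bianchi_theta_thetaBar (hsymm : η.IsSymm)
    (hJ : ∀ v, J (J v) = -v) (hηJ : ∀ v w, η (J v) (J w) = η v w)
    (hω : ∀ X, ω X ∈ valType A η J 1 1)
    (htorsion : torsion (theta η θ J + thetaBar η θ J) ω = 0) (X Y Z : Vec A) :
    (curvature ω ![X, Y] * theta η θ J Z - theta η θ J Z * curvature ω ![X, Y]) +
      (curvature ω ![Y, Z] * theta η θ J X - theta η θ J X * curvature ω ![Y, Z]) +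
      (curvature ω ![Z, X] * theta η θ J Y - theta η θ J Y * curvature ω ![Z, X]) = 0 ∧
    (curvature ω ![X, Y] * thetaBar η θ J Z - thetaBar η θ J Z * curvature ω ![X, Y]) +
      (curvature ω ![Y, Z] * thetaBar η θ J X - thetaBar η θ J X * curvature ω ![Y, Z]) +
      (curvature ω ![Z, X] * thetaBar η θ J Y - thetaBar η θ J Y * curvature ω ![Z, X]) = 0 := by
  have h := bianchi htorsion X Y Z
  have h' := congrArg (mapJVal A hηJ) h
  simp only [map_add, map_sub, map_mul, map_zero, LinearMap.add_apply, mapJVal_theta hJ,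
    mapJVal_thetaBar hJ,
    mapJVal_of_mem_valType hJ hηJ (curvature_mem_valType hsymm hJ hηJ hω _)] at h h'
  -- If `P` and `Q` are the two cyclic sums, `h` says `P + Q = 0` and `h'` says `iP - iQ = 0`. The
  -- factor `-i` turns the latter into `P - Q = 0`.
  have h'' := congrArg (fun u : Val A η => (-Complex.I) • u) h'
  simp only [mul_add, add_mul, mul_neg, neg_mul, mul_smul_comm, smul_mul_assoc, smul_add, smul_sub,
    smul_neg, neg_smul, smul_smul, Complex.I_mul_I, smul_zero] at h h''
  constructor
  · linear_combination (norm := module) (2⁻¹ : ℂ) • h + (2⁻¹ : ℂ) • h''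
  · linear_combination (norm := module) (2⁻¹ : ℂ) • h - (2⁻¹ : ℂ) • h''

/-- The subalgebra of operators that annihilate `x`. -/
def annihilator (x : Omega A η) : LieSubalgebra ℂ (Module.End ℂ (Omega A η)) where
  carrier := {T | T x = 0}
  zero_mem' := rfl
  add_mem' := fun {S T} (hS : S x = 0) (hT : T x = 0) => by
    change S x + T x = 0
    rw [hS, hT, add_zero]
  smul_mem' := fun c T (hT : T x = 0) => by
    change c • T x = 0
    rw [hT, smul_zero]
  lie_mem' := fun {S T} (hS : S x = 0) (hT : T x = 0) => by
    change S (T x) - T (S x) = 0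
    rw [hS, hT, map_zero, map_zero, sub_zero]

/-! ### The number operators on forms of type `(1, 1)` -/

/-- The terms with `c` add up to a multiple of `x(JX,Y) + x(X,JY)`, which vanishes by invariance.
Hence `c = i` and `c = -i` give the same degree, one. -/
theorem numForm_ofForm_two (hJ : ∀ v, J (J v) = -v) {x : Form A η 2}
    (hxJ : ∀ X Y, x ![almostComplex θ J X, almostComplex θ J Y] = x ![X, Y]) (c : ℂ) :
    numForm η θ J c (ofForm 2 x) = ofForm 2 x := by
  funext k
  match k with
  | 0 => exact (ofForm_of_ne (by norm_num) x).symm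
  | k + 1 =>
    change AlternatingMap.alternatizeUncurryFin
        ((2⁻¹ : ℂ) • ((ofForm 2 x (k + 1)).curryLeft -
          c • (ofForm 2 x (k + 1)).curryLeft ∘ₗ almostComplex θ J)) = ofForm 2 x (k + 1)
    by_cases hk : k = 1
    · subst hk
      rw [ofForm_self]
      ext v
      have h : x ![almostComplex θ J (v 0), v 1] = -x ![v 0, almostComplex θ J (v 1)] := by
        rw [← hxJ (v 0), almostComplex_almostComplex hJ]
        have := form_two_smul_add_right x (-1) 0 (almostComplex θ J (v 0)) (v 1) 0
        simp only [neg_smul, one_smul, zero_smul, add_zero] at this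
        rw [this, neg_neg]
      have e : ∀ f : Vec A →ₗ[A] Vec A [⋀^Fin 1]→ₗ[A] Val A η,
          AlternatingMap.alternatizeUncurryFin f v = f (v 0) ![v 1] - f (v 1) ![v 0] := by
        intro f
        have h0 : Fin.removeNth 0 v = ![v 1] := by
          ext i
          fin_cases i
          rfl
        have h1 : Fin.removeNth 1 v = ![v 0] := by
          ext i
          fin_cases i
          rfl
        rw [AlternatingMap.alternatizeUncurryFin_apply, Fin.sum_univ_two, h0, h1]
        simp [sub_eq_add_neg]
      rw [e]
      change (2⁻¹ : ℂ) • (x ![v 0, v 1] - c • x ![almostComplex θ J (v 0), v 1]) -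
        (2⁻¹ : ℂ) • (x ![v 1, v 0] - c • x ![almostComplex θ J (v 1), v 0]) = x v
      rw [form_two_eta x v, form_two_swap x (v 0) (v 1), h,
        form_two_swap x (v 0) (almostComplex θ J (v 1))]
      module
    · rw [ofForm_of_ne (by omega)]
      ext v
      simp [AlternatingMap.alternatizeUncurryFin_apply]

/-- The map `x ↦ x ∧ y` to bivectors. -/
def bivectorRight (η : LinearMap.BilinForm ℝ V) (y : ℂ ⊗[ℝ] V) : ℂ ⊗[ℝ] V →ₗ[ℂ] Cl η :=
  (2⁻¹ : ℂ) • (LinearMap.mulRight ℂ (CliffordAlgebra.ι (quad η) y) -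
    LinearMap.mulLeft ℂ (CliffordAlgebra.ι (quad η) y)) ∘ₗ CliffordAlgebra.ι (quad η)

theorem bivectorRight_apply (x y : ℂ ⊗[ℝ] V) : bivectorRight η y x = bivector η x y := rfl

/-- This and the next three lemmas say that the complex linear extensions of `holPart` and
`antiholPart` are the projections of the complexification onto its two eigenspaces. -/
theorem liftBaseChange_holPart_holPart (hJ : ∀ v, J (J v) = -v) (v : V) :
    (holPart J).liftBaseChange ℂ (holPart J v) = holPart J v := by
  conv_lhs => rw [holPart_apply v]
  rw [map_sub, LinearMap.liftBaseChange_tmul, LinearMap.liftBaseChange_tmul, ← I_smul_holPart hJ,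
    smul_smul, div_mul_eq_mul_div, Complex.I_mul_I]
  module

theorem liftBaseChange_holPart_antiholPart (hJ : ∀ v, J (J v) = -v) (v : V) :
    (holPart J).liftBaseChange ℂ (antiholPart J v) = 0 := by
  rw [antiholPart_apply v, map_add, LinearMap.liftBaseChange_tmul, LinearMap.liftBaseChange_tmul,
    ← I_smul_holPart hJ, smul_smul, div_mul_eq_mul_div, Complex.I_mul_I]
  module

theorem liftBaseChange_antiholPart_holPart (hJ : ∀ v, J (J v) = -v) (v : V) :
    (antiholPart J).liftBaseChange ℂ (holPart J v) = 0 := by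
  rw [holPart_apply v, map_sub, LinearMap.liftBaseChange_tmul, LinearMap.liftBaseChange_tmul,
    ← neg_neg (antiholPart J (J v)), ← I_smul_antiholPart hJ, smul_neg, smul_smul,
    div_mul_eq_mul_div, Complex.I_mul_I]
  module

theorem liftBaseChange_antiholPart_antiholPart (hJ : ∀ v, J (J v) = -v) (v : V) :
    (antiholPart J).liftBaseChange ℂ (antiholPart J v) = antiholPart J v := by
  conv_lhs => rw [antiholPart_apply v]
  rw [map_add, LinearMap.liftBaseChange_tmul, LinearMap.liftBaseChange_tmul,
    ← neg_neg (antiholPart J (J v)), ← I_smul_antiholPart hJ, smul_neg, smul_smul,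
    div_mul_eq_mul_div, Complex.I_mul_I]
  module

theorem bivector_zero_left (y : ℂ ⊗[ℝ] V) : bivector η 0 y = 0 := by
  simp [bivector]

theorem bivector_zero_right (x : ℂ ⊗[ℝ] V) : bivector η x 0 = 0 := by
  simp [bivector]

theorem form_sum_apply {ι : Type*} {k : ℕ} (s : Finset ι) (f : ι → Form A η k)
    (v : Fin k → Vec A) : (∑ i ∈ s, f i) v = ∑ i ∈ s, f i v :=
  map_sum (⟨⟨fun x => x v, rfl⟩, fun _ _ => rfl⟩ : Form A η k →+ Val A η) f s

theorem ofForm_two_apply_mem {x : Form A η 2} (hx : ∀ v, x v ∈ valType A η J 1 1) (k : ℕ)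
    (v : Fin k → Vec A) : ofForm 2 x k v ∈ valType A η J 1 1 := by
  by_cases hk : k = 2
  · subst hk
    rw [ofForm_self]
    exact hx v
  · rw [ofForm_of_ne hk]
    exact zero_mem _

variable [FiniteDimensional ℝ V]

/-- The operator `∑ₐ P(b^a) ∧ (b_a ⊢ u)` is the derivation of the exterior algebra that extends
the complex linear extension of `P`. -/
theorem sum_wedge_interior_bivector (hsymm : η.IsSymm) (hη : η.Nondegenerate)
    (P : V →ₗ[ℝ] ℂ ⊗[ℝ] V) (r : A) (x y : ℂ ⊗[ℝ] V) :
    ∑ a, (2⁻¹ : ℂ) • (constVal A η (P (dualVec hη a)) *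
        ((2⁻¹ : ℂ) • (constVal A η (1 ⊗ₜ[ℝ] Module.finBasis ℝ V a) *
            (r • constCl A η (bivector η x y)) -
          involuteVal (r • constCl A η (bivector η x y)) *
            constVal A η (1 ⊗ₜ[ℝ] Module.finBasis ℝ V a))) +
      involuteVal ((2⁻¹ : ℂ) • (constVal A η (1 ⊗ₜ[ℝ] Module.finBasis ℝ V a) *
            (r • constCl A η (bivector η x y)) -
          involuteVal (r • constCl A η (bivector η x y)) *
            constVal A η (1 ⊗ₜ[ℝ] Module.finBasis ℝ V a))) *
        constVal A η (P (dualVec hη a))) =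
    r • constCl A η (bivector η (P.liftBaseChange ℂ x) y + bivector η x (P.liftBaseChange ℂ y)) := by
  -- The interior product `b_a ⊢ (x ∧ y) = η(x, b_a) y - η(y, b_a) x`.
  have e : ∀ a, (2⁻¹ : ℂ) • (constVal A η (1 ⊗ₜ[ℝ] Module.finBasis ℝ V a) *
        (r • constCl A η (bivector η x y)) -
      involuteVal (r • constCl A η (bivector η x y)) *
        constVal A η (1 ⊗ₜ[ℝ] Module.finBasis ℝ V a)) =
      r • constCl A η (CliffordAlgebra.ι (quad η)
        (complexForm η x (1 ⊗ₜ[ℝ] Module.finBasis ℝ V a) • y -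
          complexForm η y (1 ⊗ₜ[ℝ] Module.finBasis ℝ V a) • x)) := by
    intro a
    rw [involuteVal_smul_constCl, involute_bivector, ← constCl_ι, mul_smul_comm, smul_mul_assoc,
      ← map_mul, ← map_mul, ← smul_sub, ← map_sub, ← neg_sub, bivector_mul_ι_sub hsymm,
      smul_smul_comm_val, ← map_smul, map_sub, LinearMap.map_smul, LinearMap.map_smul]
    congr 2
    module
  simp only [e]
  simp only [involuteVal_smul_constCl, CliffordAlgebra.involute_ι]
  -- Each wedge product is written as a linear function of `b^a`, so that the dual basis expansion
  -- can evaluate the sum.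
  have t : ∀ a, (2⁻¹ : ℂ) • (constVal A η (P (dualVec hη a)) *
        (r • constCl A η (CliffordAlgebra.ι (quad η)
          (complexForm η x (1 ⊗ₜ[ℝ] Module.finBasis ℝ V a) • y -
            complexForm η y (1 ⊗ₜ[ℝ] Module.finBasis ℝ V a) • x))) +
      (r • constCl A η (-CliffordAlgebra.ι (quad η)
          (complexForm η x (1 ⊗ₜ[ℝ] Module.finBasis ℝ V a) • y -
            complexForm η y (1 ⊗ₜ[ℝ] Module.finBasis ℝ V a) • x))) *
        constVal A η (P (dualVec hη a))) =
      r • constCl A η (complexForm η x (1 ⊗ₜ[ℝ] Module.finBasis ℝ V a) •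
          bivectorRight η y (P.liftBaseChange ℂ (1 ⊗ₜ[ℝ] dualVec hη a)) -
        complexForm η y (1 ⊗ₜ[ℝ] Module.finBasis ℝ V a) •
          bivectorRight η x (P.liftBaseChange ℂ (1 ⊗ₜ[ℝ] dualVec hη a))) := by
    intro a
    rw [LinearMap.liftBaseChange_tmul, one_smul, bivectorRight_apply, bivectorRight_apply,
      ← constCl_ι, mul_smul_comm, smul_mul_assoc, ← map_mul (constCl A η),
      ← map_mul (constCl A η), ← smul_add, ← map_add, smul_smul_comm_val, ← map_smul,
      bivector, bivector, map_sub, LinearMap.map_smul,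
      LinearMap.map_smul]
    congr 2
    simp only [neg_mul, sub_mul, mul_sub, smul_mul_assoc, mul_smul_comm]
    module
  simp only [t, ← Finset.smul_sum, ← map_sum, Finset.sum_sub_distrib]
  have s : ∀ x y, ∑ a, complexForm η x (1 ⊗ₜ[ℝ] Module.finBasis ℝ V a) •
      bivectorRight η y (P.liftBaseChange ℂ (1 ⊗ₜ[ℝ] dualVec hη a)) =
      bivector η (P.liftBaseChange ℂ x) y := by
    intro x y
    exact sum_complexForm_smul hη x (bivectorRight η y ∘ₗ P.liftBaseChange ℂ)
  rw [s, s]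
  congr 2
  rw [bivector, bivector, bivector]
  module

/-- The operator `∑ₐ P(b^a) ∧ (b_a ⊢ ·)` fixes a function of degree `(1, 1)` if `P` induces
the derivation with eigenvalue one. -/
theorem sum_wedge_interior_of_mem_valType (hsymm : η.IsSymm) (hη : η.Nondegenerate)
    (hJ : ∀ v, J (J v) = -v) (P : V →ₗ[ℝ] ℂ ⊗[ℝ] V)
    (hP : ∀ v w, bivector η (P.liftBaseChange ℂ (holPart J v)) (antiholPart J w) +
      bivector η (holPart J v) (P.liftBaseChange ℂ (antiholPart J w)) =
      bivector η (holPart J v) (antiholPart J w))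
    {u : Val A η} (hu : u ∈ valType A η J 1 1) :
    ∑ a, (2⁻¹ : ℂ) • (constVal A η (P (dualVec hη a)) *
        ((2⁻¹ : ℂ) • (constVal A η (1 ⊗ₜ[ℝ] Module.finBasis ℝ V a) * u -
          involuteVal u * constVal A η (1 ⊗ₜ[ℝ] Module.finBasis ℝ V a))) +
      involuteVal ((2⁻¹ : ℂ) • (constVal A η (1 ⊗ₜ[ℝ] Module.finBasis ℝ V a) * u -
          involuteVal u * constVal A η (1 ⊗ₜ[ℝ] Module.finBasis ℝ V a))) *
        constVal A η (P (dualVec hη a))) = u := by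
  induction hu using valType_one_one_induction hJ with
  | add u v _ _ hu hv =>
    conv_rhs => rw [← hu, ← hv]
    rw [← Finset.sum_add_distrib]
    refine Finset.sum_congr rfl fun a _ => ?_
    simp only [involuteVal_smul, map_add, map_sub, mul_add, add_mul, mul_sub, sub_mul,
      mul_smul_comm, smul_mul_assoc]
    module
  | bivector r v w => rw [sum_wedge_interior_bivector hsymm, hP]

/-- The derivation extending the projection onto `V^{1,0}` keeps one factor of the bivector and
kills the other, so its eigenvalue is one. -/
theorem numP_ofForm_two (hsymm : η.IsSymm) (hη : η.Nondegenerate) (hJ : ∀ v, J (J v) = -v)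
    {x : Form A η 2} (hx : ∀ v, x v ∈ valType A η J 1 1) :
    numP hη J (ofForm 2 x) = ofForm 2 x := by
  funext k
  ext v
  rw [numP, LinearMap.sum_apply, Finset.sum_apply, form_sum_apply]
  simp only [Module.End.mul_apply, cliffordWedge_apply, cliffordInterior_apply]
  refine sum_wedge_interior_of_mem_valType hsymm hη hJ _ (fun v w => ?_)
    (ofForm_two_apply_mem hx k v)
  rw [liftBaseChange_holPart_holPart hJ, liftBaseChange_holPart_antiholPart hJ,
    bivector_zero_right, add_zero]

theorem numPBar_ofForm_two (hsymm : η.IsSymm) (hη : η.Nondegenerate) (hJ : ∀ v, J (J v) = -v)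
    {x : Form A η 2} (hx : ∀ v, x v ∈ valType A η J 1 1) :
    numPBar hη J (ofForm 2 x) = ofForm 2 x := by
  funext k
  ext v
  rw [numPBar, LinearMap.sum_apply, Finset.sum_apply, form_sum_apply]
  simp only [Module.End.mul_apply, cliffordWedge_apply, cliffordInterior_apply]
  refine sum_wedge_interior_of_mem_valType hsymm hη hJ _ (fun v w => ?_)
    (ofForm_two_apply_mem hx k v)
  rw [liftBaseChange_antiholPart_holPart hJ, liftBaseChange_antiholPart_antiholPart hJ,
    bivector_zero_left, zero_add]

/-! ### The operators built from interior products with the frame -/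

theorem sum_wedge_interior_frame_ofForm_two (hJ : ∀ v, J (J v) = -v) (hη : η.Nondegenerate)
    {x : Form A η 2} (hx : ∀ v, x v ∈ valType A η J 1 1) (P : V →ₗ[ℝ] ℂ ⊗[ℝ] V)
    (h : ∀ X, ∑ a, (constVal A η (P (dualVec hη a)) * x ![frame θ a, X] +
      x ![frame θ a, X] * constVal A η (P (dualVec hη a))) = 0) :
    (∑ a, cliffordWedge (P (dualVec hη a)) * interior (frame θ a) :
      Module.End ℂ (Omega A η)) (ofForm 2 x) = 0 := by
  funext k
  ext v
  rw [LinearMap.sum_apply, Finset.sum_apply, form_sum_apply]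
  simp only [Module.End.mul_apply, cliffordWedge_apply, interior_apply,
    involuteVal_of_mem_valType hJ (ofForm_two_apply_mem hx _ _), ← Finset.smul_sum]
  -- The interior product lowers the form degree, so a 2-form contributes only to the component of
  -- degree one.
  by_cases hk : k = 1
  · subst hk
    have e : ∀ a, ofForm 2 x (1 + 1) (Matrix.vecCons (frame θ a) v) = x ![frame θ a, v 0] :=
      fun a => by rw [ofForm_self, form_two_eta]; rfl
    simp only [e, h, smul_zero]
    rfl
  · rw [ofForm_of_ne (by omega)]
    simp

theorem theta_frame (a : Fin (Module.finrank ℝ V)) : θ (frame θ a) = basisFun A a :=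
  θ.apply_symm_apply _

/-- Expanding `R(e_a, X)` in its contractions gives the coefficients `R(e_a, X; e_j, e_k)`. By pair
symmetry their cyclic sum over `a, j, k` is the Bianchi identity contracted with `X`, and
`sum_cyclic_eq_zero` applies. -/
theorem sum_wedge_curvature (hsymm : η.IsSymm) (hη : η.Nondegenerate)
    (hJ : ∀ v, J (J v) = -v) (hηJ : ∀ v w, η (J v) (J w) = η v w)
    (hω : ∀ X, ω X ∈ valType A η J 1 1)
    (htorsion : torsion (theta η θ J + thetaBar η θ J) ω = 0) (X : Vec A) :
    ∑ a, (constVal A η (1 ⊗ₜ[ℝ] dualVec hη a) * curvature ω ![frame θ a, X] +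
      curvature ω ![frame θ a, X] * constVal A η (1 ⊗ₜ[ℝ] dualVec hη a)) = 0 := by
  have hR := curvature_mem_valType hsymm hJ hηJ hω
  have hb : ∀ i j x, (constVal A η (1 ⊗ₜ[ℝ] dualVec hη i) * constVal A η (1 ⊗ₜ[ℝ] dualVec hη j) +
      constVal A η (1 ⊗ₜ[ℝ] dualVec hη j) * constVal A η (1 ⊗ₜ[ℝ] dualVec hη i)) * x =
      x * (constVal A η (1 ⊗ₜ[ℝ] dualVec hη i) * constVal A η (1 ⊗ₜ[ℝ] dualVec hη j) +
      constVal A η (1 ⊗ₜ[ℝ] dualVec hη j) * constVal A η (1 ⊗ₜ[ℝ] dualVec hη i)) := by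
    intro i j x
    rw [← vecVal_one_tmul, ← vecVal_one_tmul]
    exact vecVal_anticomm_mul_comm hsymm _ _ x
  have hc : ∀ i j k : Fin (Module.finrank ℝ V),
      contract (curvature ω ![frame θ i, X]) (θ (frame θ j)) (θ (frame θ k)) +
        contract (curvature ω ![frame θ j, X]) (θ (frame θ k)) (θ (frame θ i)) +
        contract (curvature ω ![frame θ k, X]) (θ (frame θ i)) (θ (frame θ j)) = 0 := by
    intro i j k
    rw [contract_curvature_pair hsymm htorsion (frame θ i) X,
      contract_curvature_pair hsymm htorsion (frame θ j) X,
      contract_curvature_pair hsymm htorsion (frame θ k) X]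
    exact contract_curvature_cyclic htorsion (frame θ j) (frame θ k) (frame θ i) (θ X)
  have key := sum_cyclic_eq_zero
    (fun i j k => contract (curvature ω ![frame θ i, X]) (θ (frame θ j)) (θ (frame θ k)))
    (fun i => constVal A η (1 ⊗ₜ[ℝ] dualVec hη i)) hb
    (fun i j k => contract_swap hsymm (curvature ω ![frame θ i, X]) _ _) hc
  have e : ∀ a, (-8 : ℂ) • curvature ω ![frame θ a, X] = ∑ j, ∑ k,
      contract (curvature ω ![frame θ a, X]) (θ (frame θ j)) (θ (frame θ k)) *
        (constVal A η (1 ⊗ₜ[ℝ] dualVec hη j) * constVal A η (1 ⊗ₜ[ℝ] dualVec hη k)) := by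
    intro a
    simp only [theta_frame]
    exact (sum_contract_mul hsymm hη hJ (hR _)).symm
  have h : (-8 : ℂ) • ∑ a, (constVal A η (1 ⊗ₜ[ℝ] dualVec hη a) * curvature ω ![frame θ a, X] +
      curvature ω ![frame θ a, X] * constVal A η (1 ⊗ₜ[ℝ] dualVec hη a)) = 0 := by
    rw [← key, Finset.smul_sum]
    refine Finset.sum_congr rfl fun a _ => ?_
    rw [smul_add, ← mul_smul_comm, ← smul_mul_assoc, e]
    simp only [Finset.mul_sum, Finset.sum_mul, ← Finset.sum_add_distrib]
    refine Finset.sum_congr rfl fun j _ => Finset.sum_congr rfl fun k _ => ?_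
    -- The coefficient is central and can be moved to the left of `b^a`.
    rw [mul_add, ← mul_assoc, ← contract_mul_comm hsymm hJ (hR _), mul_assoc, mul_assoc _ (_ * _)]
  exact (smul_eq_zero.1 h).resolve_left (by norm_num)

/-- The automorphism induced by `J` fixes the values of the curvature and replaces `b^a` by `J b^a`.
-/
theorem sum_wedge_curvature_J (hsymm : η.IsSymm) (hη : η.Nondegenerate)
    (hJ : ∀ v, J (J v) = -v) (hηJ : ∀ v w, η (J v) (J w) = η v w)
    (hω : ∀ X, ω X ∈ valType A η J 1 1)
    (htorsion : torsion (theta η θ J + thetaBar η θ J) ω = 0) (X : Vec A) :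
    ∑ a, (constVal A η (1 ⊗ₜ[ℝ] J (dualVec hη a)) * curvature ω ![frame θ a, X] +
      curvature ω ![frame θ a, X] * constVal A η (1 ⊗ₜ[ℝ] J (dualVec hη a))) = 0 := by
  have h := congrArg (mapJVal A hηJ) (sum_wedge_curvature hsymm hη hJ hηJ hω htorsion X)
  simpa only [map_sum, map_add, map_mul, map_zero, mapJVal_constVal, LinearMap.baseChange_tmul,
    mapJVal_of_mem_valType hJ hηJ (curvature_mem_valType hsymm hJ hηJ hω _)] using h

theorem sum_wedge_antiholPart_curvature (hsymm : η.IsSymm) (hη : η.Nondegenerate)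
    (hJ : ∀ v, J (J v) = -v) (hηJ : ∀ v w, η (J v) (J w) = η v w)
    (hω : ∀ X, ω X ∈ valType A η J 1 1)
    (htorsion : torsion (theta η θ J + thetaBar η θ J) ω = 0) (X : Vec A) :
    ∑ a, (constVal A η (antiholPart J (dualVec hη a)) * curvature ω ![frame θ a, X] +
      curvature ω ![frame θ a, X] * constVal A η (antiholPart J (dualVec hη a))) = 0 := by
  -- The two zeros are then replaced by the vanishing sums for `b^a` and `J b^a`, whose combination
  -- is the sum for `antiholPart`.
  have h : (2⁻¹ : ℂ) • ((0 : Val A η) + Complex.I • (0 : Val A η)) = 0 := by simp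
  rw [← h]
  nth_rw 1 [← sum_wedge_curvature hsymm hη hJ hηJ hω htorsion X]
  rw [← sum_wedge_curvature_J hsymm hη hJ hηJ hω htorsion X, Finset.smul_sum,
    ← Finset.sum_add_distrib, Finset.smul_sum]
  refine Finset.sum_congr rfl fun a _ => ?_
  simp only [constVal_antiholPart, smul_mul_assoc, mul_smul_comm, add_mul, mul_add]
  module

theorem sum_wedge_holPart_curvature (hsymm : η.IsSymm) (hη : η.Nondegenerate)
    (hJ : ∀ v, J (J v) = -v) (hηJ : ∀ v w, η (J v) (J w) = η v w)
    (hω : ∀ X, ω X ∈ valType A η J 1 1)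
    (htorsion : torsion (theta η θ J + thetaBar η θ J) ω = 0) (X : Vec A) :
    ∑ a, (constVal A η (holPart J (dualVec hη a)) * curvature ω ![frame θ a, X] +
      curvature ω ![frame θ a, X] * constVal A η (holPart J (dualVec hη a))) = 0 := by
  have h : (2⁻¹ : ℂ) • ((0 : Val A η) - Complex.I • (0 : Val A η)) = 0 := by simp
  rw [← h]
  nth_rw 1 [← sum_wedge_curvature hsymm hη hJ hηJ hω htorsion X]
  rw [← sum_wedge_curvature_J hsymm hη hJ hηJ hω htorsion X, Finset.smul_sum,
    ← Finset.sum_sub_distrib, Finset.smul_sum]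
  refine Finset.sum_congr rfl fun a _ => ?_
  simp only [constVal_holPart, smul_mul_assoc, mul_smul_comm, sub_mul, mul_sub]
  module

/-! ### The six generators and the subalgebra they generate -/

theorem kahlerOperators_le_annihilator (hsymm : η.IsSymm) (hη : η.Nondegenerate)
    (hJ : ∀ v, J (J v) = -v) (hηJ : ∀ v w, η (J v) (J w) = η v w)
    (hω : ∀ X, ω X ∈ valType A η J 1 1)
    (htorsion : torsion (theta η θ J + thetaBar η θ J) ω = 0) :
    kahlerOperators hη θ J ≤ annihilator (ofForm 2 (curvature ω)) := by
  have hR := curvature_mem_valType hsymm hJ hηJ hω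
  have hRi := fun v => involuteVal_of_mem_valType hJ (hR v)
  have hRJ := curvature_almostComplex hsymm hη hJ hηJ hω htorsion
  rw [kahlerOperators, LieSubalgebra.lieSpan_le]
  rintro T (rfl | rfl | rfl | rfl | rfl | rfl)
  · exact sum_wedge_interior_frame_ofForm_two hJ hη hR (antiholPart J)
      (sum_wedge_antiholPart_curvature hsymm hη hJ hηJ hω htorsion)
  · exact superMinus_ofForm_two hRi (leftProd_eq_rightProd fun X Y Z =>
      (bianchi_theta_thetaBar hsymm hJ hηJ hω htorsion X Y Z).1)
  · change numPBar hη J _ - numForm η θ J Complex.I _ = 0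
    rw [numPBar_ofForm_two hsymm hη hJ hR, numForm_ofForm_two hJ hRJ, sub_self]
  · exact superMinus_ofForm_two hRi (leftProd_eq_rightProd fun X Y Z =>
      (bianchi_theta_thetaBar hsymm hJ hηJ hω htorsion X Y Z).2)
  · exact sum_wedge_interior_frame_ofForm_two hJ hη hR (holPart J)
      (sum_wedge_holPart_curvature hsymm hη hJ hηJ hω htorsion)
  · change numForm η θ J (-Complex.I) _ - numP hη J _ = 0
    rw [numP_ofForm_two hsymm hη hJ hR, numForm_ofForm_two hJ hRJ, sub_self]

theorem kahlerOperators_le_affineOperators (hη : η.Nondegenerate) :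
    kahlerOperators hη θ J ≤ affineOperators hη θ J := by
  apply LieSubalgebra.lieSpan_mono
  rintro T (rfl | rfl | rfl | rfl | rfl | rfl)
  · exact Or.inl (Or.inl ⟨1, rfl⟩)
  · exact Or.inl (Or.inr ⟨1, rfl⟩)
  · exact Or.inr ⟨1, rfl⟩
  · exact Or.inl (Or.inl ⟨3, rfl⟩)
  · exact Or.inl (Or.inr ⟨3, rfl⟩)
  · exact Or.inr ⟨3, rfl⟩

end Operators

end
end CliffordForms

open CliffordForms in
theorem proposition6 {E M V : Type*} [NormedAddCommGroup E] [NormedSpace ℝ E]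
    [FiniteDimensional ℝ E] [TopologicalSpace M] [ChartedSpace E M]
    [IsManifold 𝓘(ℝ, E) ((⊤ : ℕ∞) : WithTop ℕ∞) M] [T2Space M] [SigmaCompactSpace M]
    [AddCommGroup V] [Module ℝ V] [FiniteDimensional ℝ V]
    (η : LinearMap.BilinForm ℝ V) (hsymm : η.IsSymm) (hη : η.Nondegenerate)
    (J : V →ₗ[ℝ] V) (hJ : ∀ v, J (J v) = -v) (hηJ : ∀ v w, η (J v) (J w) = η v w)
    (θ : Vielbein (Smooth E M) V) (ω ω' : OneForm (Smooth E M) η)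
    (hω : ofForm 1 (oneForm ω) ∈ OmegaType θ η J 1 1 1 0)
    (hω' : ofForm 1 (oneForm ω') ∈ OmegaType θ η J 1 1 0 1)
    (htorsion : torsion (theta η θ J + thetaBar η θ J) (ω + ω') = 0) :
    curvature (ω + ω') = del θ J ω' + delBar θ J ω + prod ω ω' + prod ω' ω ∧
    ofForm 2 (curvature (ω + ω')) ∈ OmegaType θ η J 1 1 1 1 ∧
    kahlerOperators hη θ J ≤ affineOperators hη θ J ∧
    ∀ T ∈ kahlerOperators hη θ J, T (ofForm 2 (curvature (ω + ω'))) = 0 := by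
  have h : ∀ X, (ω + ω') X ∈ valType (Smooth E M) η J 1 1 := fun X =>
    add_mem (mem_valType_of_mem_OmegaType_one_zero hω X)
      (mem_valType_of_mem_OmegaType_zero_one hω' X)
  have hR := curvature_almostComplex hsymm hη hJ hηJ h htorsion
  exact ⟨curvature_eq (apply_almostComplex_of_mem_OmegaType_one_zero hω)
      (apply_almostComplex_of_mem_OmegaType_zero_one hω') hR,
    ofForm_mem_OmegaType_one_one hJ (fun X Y => curvature_mem_valType hsymm hJ hηJ h _) hR,
    kahlerOperators_le_affineOperators hη,
    fun T hT => kahlerOperators_le_annihilator hsymm hη hJ hηJ h htorsion hT⟩
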